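/- **Counter machine.** Let $S=\{s_0,\dots,s_{m-1}\}$, $m\ge 1$, and let $\Gamma:S\times\{0,1\}^2\to S\times\{-2,-1,0,1,2\}$ be the update function of a two-counter machine. A configuration is $(s,z_1,z_2)\in S\times\mathbb Z_+^2$; with $b_i=1$ if $z_i>0$ and $b_i=0$ otherwise, and $\Gamma(s,b)=(s',a)$, the state becomes $s'$ and counter $|a|$ changes by $\operatorname{sign}(a)$ (no counter changes if $a=0$). A zero counter is never decremented. Assume also that no rule which leaves $s_0$ increments a counter: if $\Gamma(s_0,b)=(s',a)$ with $s'\ne s_0$, then $a\le 0$. The initial and the halting configuration are both $(s_0,0,0)$; the machine *halts in $T$ steps* ($T\ge 1$) if, started in $(s_0,0,0)$, it is in $(s_0,0,0)$ again for the first time after exactly $T$ updates, and it *does not halt* if this happens for no $T$. **Deterministic update.** For $Q\in\mathbb Z_+^{m+1}$ let $\Lambda=\{k: Q_k>0\}$ and define $\Delta(Q)\in\{-1,0,1\}^{m+1}$, depending only on $\Lambda$, as follows. Put $\epsilon_0=0$ and $\epsilon_i=e_i$ for $1\le i\le m-1$, and encode $(s_i,z_1,z_2)$ by $(\epsilon_i,z_1,z_2)$.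 If $\Lambda\cap\{1,\dots,m-1\}$ is empty (take $i=0$) or equals $\{i\}$, let $(s_j,a)=\Gamma(s_i,b)$, with $b_1,b_2$ the indicators of $m\in\Lambda$ and $m+1\in\Lambda$, and let $\Delta(Q)$ be $\epsilon_j-\epsilon_i$ in the first $m-1$ coordinates and the change of the two counters prescribed by $a$ in the last two. Otherwise $\Delta(Q)=-e_k$ with $k=\min\Lambda$. **The walk.** Fix $0<p<1$. The random walk $\bar Q(t)=(Q(t),q_1(t),q_2(t))$ on $\mathbb Z_+^{m+3}$ moves as follows. * If $q_2(t)>0$: $Q(t+1)=Q(t)+\Delta(Q(t))$; $q_1$ changes by the amount for which $\sum_iQ_i+q_1$ increases by exactly $1$; if $Q(t)\neq0$, then $q_2$ is unchanged with probability $p$ and decreases by $1$ with probability $1-p$, and if $Q(t)=0$, then $q_2$ decreases by $1$ with probability $1$. * If $q_2(t)=0$ and $\bar Q(t)\ne0$: the positive coordinate of $\bar Q(t)$ with the smallest index decreases by $1$ and nothing else changes. * If $\bar Q(t)=0$: $(Q,q_1)$ moves as in the first case, and $q_2(t+1)=1$ with probability $p$, $q_2(t+1)=0$ with probability $1-p$.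 **Proposition.** The walk $\bar Q$ is irreducible in the following sense: for every state $q$ there is $t\ge0$ with $p^{(t)}(q,0)>0$; thus from every state one can reach every state that is accessible from $0$. It is positive recurrent: for some $C_0>0$ and from every initial state, the set $\{z:\sum_i z_i\le C_0\}$ is visited infinitely often with probability one and its expected hitting time is finite. It has a unique stationary distribution $\pi$. Moreover: 1. If the machine does not halt, then the time of the first return to $0$ of the walk started at $0$ equals $2t+2$ with probability $(1-p)p^t$ for every $t=0,1,2,\dots$, and the expected return time is $1/\pi(0)=2/(1-p)$. 2. If the machine halts in $T\ge1$ steps, then this return time equals $2t+2$ with probability $(1-p)p^t$ for every $0\le t<T$ and equals $2T+2$ with the remaining probability $p^T$, and the expected return time is $1/\pi(0)=(2-2p^{T+1})/(1-p)$. 3. For every real $C\ge 2/(1-p)$ the function $\Phi(\bar q)=\sum_{i=1}^{m+1}Q_i+q_1+Cq_2$ is a linear Lyapunov function with drift $-1$ and exception set $\{0\}$: it is linear with nonnegative coefficients, and $E[\Phi(\bar Q(t+1))\mid\bar Q(t)=\bar q]-\Phi(\bar q)\le-1$ for every $\bar q\neq0$. -/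

import Mathlib

open MeasureTheory ProbabilityTheory
open scoped ENNReal

noncomputable section

/-! ### Face-homogeneous constrained random walks on `ℤ₊^d` -/

/-- A constrained homogeneous random walk on the nonnegative lattice `ℕ^d`. The law of the
transition vector `Δ` depends only on the face, that is on the set `Λ` of the positive coordinates
of the current state; it has finite support, no coordinate decreases by more than one, and a
coordinate that vanishes does not decrease. -/
structure ConstrainedWalk (d : ℕ) where
  /-- `jump Λ Δ` is the probability of the transition vector `Δ` on the face `Λ`. -/
  jump : Finset (Fin d) → PMF (Fin d → ℤ)
  finite_support : ∀ Λ, (jump Λ).support.Finite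
  neg_one_le : ∀ Λ, ∀ Δ ∈ (jump Λ).support, ∀ i, -1 ≤ Δ i
  consistent : ∀ Λ, ∀ Δ ∈ (jump Λ).support, ∀ i ∉ Λ, 0 ≤ Δ i

namespace ConstrainedWalk

variable {d : ℕ}

/-- The set of positive coordinates of a state. -/
def face (q : Fin d → ℕ) : Finset (Fin d) := Finset.univ.filter fun i => 0 < q i

variable (W : ConstrainedWalk d)

/-- The one-step transition law: `W.trans q q'` is `p(q, q')`. By the fields `neg_one_le` and
`consistent` the truncation `Int.toNat` is never active on the support of the jump law. -/
def trans (q : Fin d → ℕ) : PMF (Fin d → ℕ) :=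
  (W.jump (face q)).map fun Δ i => ((q i : ℤ) + Δ i).toNat

/-- No truncation takes place in `trans`. -/
theorem toNat_exact (q : Fin d → ℕ) (Δ : Fin d → ℤ) (hΔ : Δ ∈ (W.jump (face q)).support)
    (i : Fin d) : ((((q i : ℤ) + Δ i).toNat : ℕ) : ℤ) = (q i : ℤ) + Δ i := by
  apply Int.toNat_of_nonneg
  by_cases h : i ∈ face q
  · have h1 := W.neg_one_le _ _ hΔ i
    have h2 : 0 < q i := by simpa [face] using h
    omega
  · have h1 := W.consistent _ _ hΔ i h
    omega

/-- The `t`-step transition law: `W.nStep t q q'` is `p^{(t)}(q, q')`. -/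
def nStep : ℕ → (Fin d → ℕ) → PMF (Fin d → ℕ)
  | 0, q => PMF.pure q
  | t + 1, q => (nStep t q).bind W.trans

/-- The transition law as a Markov kernel. -/
def kernel : Kernel (Fin d → ℕ) (Fin d → ℕ) :=
  Kernel.ofFunOfCountable fun q => (W.trans q).toMeasure

instance : IsMarkovKernel W.kernel :=
  ⟨fun q => inferInstanceAs (IsProbabilityMeasure (W.trans q).toMeasure)⟩

/-- The law of the trajectory `Q(0), Q(1), …` of the walk with the initial state `Q(0) = q`. -/
def pathLaw (q : Fin d → ℕ) : Measure (ℕ → Fin d → ℕ) :=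
  Kernel.traj (X := fun _ => Fin d → ℕ)
    (fun t => W.kernel.comap
      (fun x : (Finset.Iic t) → (Fin d → ℕ) => x ⟨t, Finset.mem_Iic.2 le_rfl⟩)
      (measurable_pi_apply _)) 0 fun _ => q

/-- The first hitting time of `X`, infinite if `X` is never visited. -/
def hittingTime (X : Set (Fin d → ℕ)) (ω : ℕ → Fin d → ℕ) : ℕ∞ :=
  ⨅ (t : ℕ) (_ : ω t ∈ X), (t : ℕ∞)

/-- The first time `t ≥ 1` at which the trajectory is at the origin, infinite if there is none. -/
def returnTime (ω : ℕ → Fin d → ℕ) : ℕ∞ :=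
  ⨅ (t : ℕ) (_ : 1 ≤ t ∧ ω t = 0), (t : ℕ∞)

/-- Every state communicates with the origin: `p^{(t)}(q, 0) > 0` for some `t ≥ 0`. -/
def CommunicatesWithZero : Prop := ∀ q, ∃ t, 0 < W.nStep t q 0

/-- From every state of the lattice, every state that is accessible from the origin can be reached.
Thus the states accessible from the origin form a single communicating class, and it is accessible
from everywhere. -/
def Irreducible : Prop :=
  ∀ q q', (∃ s, 0 < W.nStep s 0 q') → ∃ t, 0 < W.nStep t q q'

/-- Positive recurrence: for some `C > 0` the set `X_C` of the states of `L¹` norm at most `C`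
is visited infinitely often with probability one and its expected hitting time is finite, from
every initial state. -/
def PositiveRecurrent : Prop :=
  ∃ C : ℝ, 0 < C ∧ ∀ q,
    (∀ᵐ ω ∂W.pathLaw q, ∃ᶠ t in Filter.atTop, ω t ∈ {z : Fin d → ℕ | ∑ i, (z i : ℝ) ≤ C}) ∧
    ∫⁻ ω, (hittingTime {z : Fin d → ℕ | ∑ i, (z i : ℝ) ≤ C} ω : ℝ≥0∞) ∂W.pathLaw q < ∞

/-- `π` is a stationary distribution of the walk. -/
def IsStationary (π : PMF (Fin d → ℕ)) : Prop :=
  ∀ q, ∑' q', π q' * W.trans q' q = π q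

/-- `Φ` is a Lyapunov function with drift `-γ < 0` and exception set `B`. -/
def IsLyapunov (Φ : (Fin d → ℕ) → ℝ) (γ : ℝ) (B : Set (Fin d → ℕ)) : Prop :=
  (∀ q, 0 ≤ Φ q) ∧ 0 < γ ∧ B.Finite ∧ ∀ q ∉ B,
    (Summable fun q' => Φ q' * (W.trans q q').toReal) ∧
    (∑' q', Φ q' * (W.trans q q').toReal) - Φ q ≤ -γ

/-- `Φ` is a Lyapunov function of the form `Φ(q) = ∑ wᵢ qᵢ` with `wᵢ ≥ 0`. -/
def IsLinearLyapunov (Φ : (Fin d → ℕ) → ℝ) (γ : ℝ) (B : Set (Fin d → ℕ)) : Prop :=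
  W.IsLyapunov Φ γ B ∧ ∃ w : Fin d → ℝ, (∀ i, 0 ≤ w i) ∧ ∀ q, Φ q = ∑ i, w i * q i

end ConstrainedWalk

/-! ### Counter machines with two counters -/

/-- The action of an update rule on the two counters. -/
inductive CounterOp where
  | stay
  | inc (i : Fin 2)
  | dec (i : Fin 2)

/-- The increment of the two counters. -/
def CounterOp.delta : CounterOp → Fin 2 → ℤ
  | stay => 0
  | inc i => Pi.single i 1
  | dec i => Pi.single i (-1)

/-- A counter machine with the `n + 1` states `s_0, …, s_n`. The update function `Γ` reads the
current state and, for each of the two counters, whether it is positive; it never decrements a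
counter that is zero. -/
structure CounterMachine (n : ℕ) where
  Γ : Fin (n + 1) → (Fin 2 → Bool) → Fin (n + 1) × CounterOp
  dec_pos : ∀ s b i, (Γ s b).2 = CounterOp.dec i → b i = true

namespace CounterMachine

variable {n : ℕ} (M : CounterMachine n)

/-- The update of the configuration `(s, z)`. By `dec_pos` the truncation is never active. -/
def step (c : Fin (n + 1) × (Fin 2 → ℕ)) : Fin (n + 1) × (Fin 2 → ℕ) :=
  let r := M.Γ c.1 fun i => decide (0 < c.2 i)
  (r.1, fun i => ((c.2 i : ℤ) + r.2.delta i).toNat)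

/-- The configuration after `t` updates from the initial configuration `(s_0, 0, 0)`. -/
def config (t : ℕ) : Fin (n + 1) × (Fin 2 → ℕ) := M.step^[t] (0, 0)

/-- Started in `(s_0, 0, 0)`, which is also the halting configuration, the machine reaches the
halting configuration for the first time after exactly `T ≥ 1` updates. -/
def HaltsIn (T : ℕ) : Prop :=
  1 ≤ T ∧ M.config T = (0, 0) ∧ ∀ t, 1 ≤ t → t < T → M.config t ≠ (0, 0)

/-- No rule that leaves the state `s_0` increments a counter. With a configuration encoded by the
unit vector of its state (zero for `s_0`) and its counters, this says exactly that no update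
increases the norm of the encoding by two. -/
def NoIncrementOnLeaving : Prop :=
  ∀ b, (M.Γ 0 b).1 ≠ 0 → ∀ i, (M.Γ 0 b).2 ≠ CounterOp.inc i

/-! ### The walk built from a counter machine

It lives on `ℕ^(n+4)`: the coordinates `0, …, n-1` encode the states `s_1, …, s_n` by unit vectors
(the state `s_0` by zero), the coordinates `n` and `n+1` are the two counters, and the last two
coordinates are `q₁` and `q₂`. -/

/-- The coordinate of the state `s_(k+1)`. -/
def stateCoord (k : Fin n) : Fin (n + 4) := ⟨k, by omega⟩

/-- The coordinate of the counter `i`. -/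
def counterCoord (i : Fin 2) : Fin (n + 4) := ⟨n + i, by omega⟩

/-- The coordinate `q₁`. -/
def q₁ : Fin (n + 4) := ⟨n + 2, by omega⟩

/-- The coordinate `q₂`. -/
def q₂ : Fin (n + 4) := ⟨n + 3, by omega⟩

/-- The vector that encodes the state `s`: zero for `s_0` and a unit vector otherwise. -/
def stateVec (s : Fin (n + 1)) : Fin (n + 4) → ℤ :=
  fun c => if (c : ℕ) + 1 = s then 1 else 0

/-- The action on the counters as a vector of the lattice. -/
def opVec (o : CounterOp) : Fin (n + 4) → ℤ :=
  fun c => ∑ i : Fin 2, if c = counterCoord i then o.delta i else 0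

/-- The face `Λ` corresponds to configurations with the state `s`. -/
def Encodes (Λ : Finset (Fin (n + 4))) (s : Fin (n + 1)) : Prop :=
  ∀ k : Fin n, stateCoord k ∈ Λ ↔ (k : ℕ) + 1 = s

open Classical in
/-- The vector `-e_k`, with `k` the smallest element of `Λ` (zero if `Λ` is empty). -/
def decSmallest (Λ : Finset (Fin (n + 4))) : Fin (n + 4) → ℤ :=
  fun c => if IsLeast (Λ : Set (Fin (n + 4))) c then -1 else 0

open Classical in
/-- The deterministic update of the first part `Q` (states and counters; it is zero in the
coordinates `q₁` and `q₂`): the rule of the machine on the faces that correspond to configurations,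
and otherwise a unit decrement of the smallest positive coordinate. -/
def baseJump (Λ : Finset (Fin (n + 4))) : Fin (n + 4) → ℤ :=
  if h : ∃ s, Encodes Λ s then
    let r := M.Γ h.choose fun i => decide (counterCoord i ∈ Λ)
    stateVec r.1 - stateVec h.choose + opVec r.2
  else decSmallest Λ

/-- The update of `(Q, q₁)`: the increment of `q₁` is such that the norm `∑ Q_i + q₁`
increases by exactly one. -/
def mainJump (Λ : Finset (Fin (n + 4))) : Fin (n + 4) → ℤ :=
  M.baseJump Λ + Pi.single q₁ (1 - ∑ c, M.baseJump Λ c)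

/-- A coin that shows `true` with probability `p`. -/
def coin (p : ℝ) (h0 : 0 ≤ p) (h1 : p ≤ 1) : PMF Bool :=
  PMF.ofFintype (fun b => if b then ENNReal.ofReal p else ENNReal.ofReal (1 - p)) (by
    simp [← ENNReal.ofReal_add h0 (sub_nonneg.2 h1)])

open Classical in
/-- The law of the transition vector on the face `Λ`.

If `q₂ > 0`, then `(Q, q₁)` moves by `mainJump`; `q₂` decreases by one with probability one if
`Q = 0`, and otherwise stays with probability `p` and decreases by one with probability `1 - p`.

If `q₂ = 0` and the state is not the origin, the smallest positive coordinate decreases by one.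

At the origin, `(Q, q₁)` moves by `mainJump`, and `q₂` becomes one with probability `p`. -/
def jumpLaw (p : ℝ) (h0 : 0 ≤ p) (h1 : p ≤ 1) (Λ : Finset (Fin (n + 4))) :
    PMF (Fin (n + 4) → ℤ) :=
  if q₂ ∈ Λ then
    if ∀ c ∈ Λ, c = q₁ ∨ c = q₂ then PMF.pure (M.mainJump Λ - Pi.single q₂ 1)
    else (coin p h0 h1).map fun b => if b then M.mainJump Λ else M.mainJump Λ - Pi.single q₂ 1
  else if Λ.Nonempty then PMF.pure (decSmallest Λ)
  else (coin p h0 h1).map fun b => if b then M.mainJump Λ + Pi.single q₂ 1 else M.mainJump Λ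

/-! Consistency of the construction -/

theorem delta_ge (o : CounterOp) (i : Fin 2) : -1 ≤ o.delta i := by
  cases o <;> simp [CounterOp.delta, Pi.single_apply] <;> split_ifs <;> simp

theorem sum_delta_le (o : CounterOp) : ∑ i, o.delta i ≤ 1 := by
  cases o <;> simp [CounterOp.delta]

theorem sum_delta_le_zero (o : CounterOp) (h : ∀ i, o ≠ CounterOp.inc i) :
    ∑ i, o.delta i ≤ 0 := by
  cases o with
  | stay => simp [CounterOp.delta]
  | inc i => exact absurd rfl (h i)
  | dec i => simp [CounterOp.delta]

theorem sum_opVec (o : CounterOp) : ∑ c, opVec (n := n) o c = ∑ i, o.delta i := by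
  unfold opVec
  rw [Finset.sum_comm]
  simp

theorem sum_stateVec (s : Fin (n + 1)) :
    ∑ c, stateVec s c = if s = 0 then 0 else 1 := by
  split_ifs with h
  · subst h; simp [stateVec]
  · have hs : (s : ℕ) ≠ 0 := fun h' => h (Fin.ext h')
    rw [Finset.sum_eq_single (⟨(s : ℕ) - 1, by omega⟩ : Fin (n + 4))]
    · simp only [stateVec]; rw [if_pos]; omega
    · intro c _ hc
      simp only [stateVec]; rw [if_neg]
      intro h'; apply hc; ext; simp; omega
    · simp

theorem opVec_nonneg (o : CounterOp) (c : Fin (n + 4))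
    (h : ∀ i, c = counterCoord i → 0 ≤ o.delta i) : 0 ≤ opVec o c := by
  unfold opVec
  refine Finset.sum_nonneg fun i _ => ?_
  split_ifs with hc
  · exact h i hc
  · exact le_rfl

theorem opVec_ge (o : CounterOp) (c : Fin (n + 4)) : -1 ≤ opVec o c := by
  unfold opVec
  rw [Fin.sum_univ_two]
  have h0 := delta_ge o 0
  have h1 := delta_ge o 1
  have : ¬ (c = counterCoord 0 ∧ c = counterCoord 1) := by
    rintro ⟨h, h'⟩
    simp only [counterCoord, Fin.ext_iff] at h h'
    simp at h h'
    omega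
  split_ifs <;> simp_all

theorem baseJump_of_encodes {Λ : Finset (Fin (n + 4))} {s : Fin (n + 1)} (h : Encodes Λ s) :
    M.baseJump Λ = stateVec (M.Γ s fun i => decide (counterCoord i ∈ Λ)).1 - stateVec s
      + opVec (M.Γ s fun i => decide (counterCoord i ∈ Λ)).2 := by
  have hex : ∃ s, Encodes Λ s := ⟨s, h⟩
  have hs : hex.choose = s := by
    have h' := hex.choose_spec
    by_contra hne
    have hne' : (hex.choose : ℕ) ≠ s := fun e => hne (Fin.ext e)
    by_cases h0 : (s : ℕ) = 0
    · have := (h ⟨(hex.choose : ℕ) - 1, by omega⟩).1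
        ((h' ⟨(hex.choose : ℕ) - 1, by omega⟩).2 (by simp; omega))
      simp at this; omega
    · have := (h' ⟨(s : ℕ) - 1, by omega⟩).1
        ((h ⟨(s : ℕ) - 1, by omega⟩).2 (by simp; omega))
      simp at this; omega
  unfold baseJump
  rw [dif_pos hex, hs]

theorem baseJump_of_not_encodes {Λ : Finset (Fin (n + 4))} (h : ¬ ∃ s, Encodes Λ s) :
    M.baseJump Λ = decSmallest Λ := by
  unfold baseJump
  rw [dif_neg h]

theorem decSmallest_ge (Λ : Finset (Fin (n + 4))) (c : Fin (n + 4)) : -1 ≤ decSmallest Λ c := by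
  unfold decSmallest; split_ifs <;> simp

theorem decSmallest_nonpos (Λ : Finset (Fin (n + 4))) (c : Fin (n + 4)) :
    decSmallest Λ c ≤ 0 := by
  unfold decSmallest; split_ifs <;> simp

theorem decSmallest_of_notMem {Λ : Finset (Fin (n + 4))} {c : Fin (n + 4)} (h : c ∉ Λ) :
    decSmallest Λ c = 0 := by
  unfold decSmallest; rw [if_neg]; exact fun h' => h (by simpa using h'.1)

theorem baseJump_nonneg {Λ : Finset (Fin (n + 4))} {c : Fin (n + 4)} (hc : c ∉ Λ) :
    0 ≤ M.baseJump Λ c := by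
  by_cases h : ∃ s, Encodes Λ s
  · obtain ⟨s, h⟩ := h
    rw [M.baseJump_of_encodes h]
    have h1 : stateVec s c = 0 := by
      unfold stateVec
      rw [if_neg]
      intro e
      exact hc ((h ⟨c, by omega⟩).2 e)
    have h2 : 0 ≤ stateVec (M.Γ s fun i => decide (counterCoord i ∈ Λ)).1 c := by
      unfold stateVec; split_ifs <;> simp
    have h3 := opVec_nonneg (M.Γ s fun i => decide (counterCoord i ∈ Λ)).2 c (by
      intro i e
      have hp := M.dec_pos s fun i => decide (counterCoord i ∈ Λ)
      revert hp
      cases (M.Γ s fun i => decide (counterCoord i ∈ Λ)).2 with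
      | stay => simp [CounterOp.delta]
      | inc j => intro _; simp only [CounterOp.delta, Pi.single_apply]; split_ifs <;> simp
      | dec j =>
        intro hp
        have := hp j rfl
        simp only [decide_eq_true_eq] at this
        have hij : i ≠ j := by rintro rfl; exact hc (e ▸ this)
        simp [CounterOp.delta, hij])
    simp only [Pi.add_apply, Pi.sub_apply]
    omega
  · rw [M.baseJump_of_not_encodes h, decSmallest_of_notMem hc]

theorem baseJump_ge (Λ : Finset (Fin (n + 4))) (c : Fin (n + 4)) : -1 ≤ M.baseJump Λ c := by
  by_cases h : ∃ s, Encodes Λ s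
  · obtain ⟨s, h⟩ := h
    rw [M.baseJump_of_encodes h]
    have h2 : 0 ≤ stateVec (M.Γ s fun i => decide (counterCoord i ∈ Λ)).1 c := by
      unfold stateVec; split_ifs <;> simp
    have h3 := opVec_ge (M.Γ s fun i => decide (counterCoord i ∈ Λ)).2 c
    simp only [Pi.add_apply, Pi.sub_apply]
    by_cases e : (c : ℕ) + 1 = s
    · have h4 : 0 ≤ opVec (M.Γ s fun i => decide (counterCoord i ∈ Λ)).2 c := by
        refine opVec_nonneg _ c fun i hi => ?_
        have : (c : ℕ) = n + i := by rw [hi]; rfl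
        omega
      have h5 : stateVec s c = 1 := by unfold stateVec; rw [if_pos e]
      omega
    · have h5 : stateVec s c = 0 := by unfold stateVec; rw [if_neg e]
      omega
  · rw [M.baseJump_of_not_encodes h]; exact decSmallest_ge Λ c

theorem sum_baseJump_le (hM : M.NoIncrementOnLeaving) (Λ : Finset (Fin (n + 4))) :
    ∑ c, M.baseJump Λ c ≤ 1 := by
  by_cases h : ∃ s, Encodes Λ s
  · obtain ⟨s, h⟩ := h
    rw [M.baseJump_of_encodes h]
    simp only [Pi.add_apply, Pi.sub_apply, Finset.sum_add_distrib, Finset.sum_sub_distrib,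
      sum_opVec, sum_stateVec]
    have h1 := sum_delta_le (M.Γ s fun i => decide (counterCoord i ∈ Λ)).2
    by_cases hs : s = 0
    · subst hs
      by_cases h0 : (M.Γ 0 fun i => decide (counterCoord i ∈ Λ)).1 = 0
      · simpa [h0] using h1
      · have := sum_delta_le_zero _ (hM _ h0)
        rw [if_neg h0, if_pos rfl]; omega
    · rw [if_neg hs]; split_ifs <;> omega
  · rw [M.baseJump_of_not_encodes h]
    exact (Finset.sum_nonpos fun c _ => decSmallest_nonpos Λ c).trans zero_le_one

theorem mainJump_ge (hM : M.NoIncrementOnLeaving) (Λ : Finset (Fin (n + 4))) (c : Fin (n + 4)) :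
    M.baseJump Λ c ≤ M.mainJump Λ c := by
  have := M.sum_baseJump_le hM Λ
  simp only [mainJump, Pi.add_apply, Pi.single_apply]
  split_ifs <;> omega

theorem q₂_baseJump (Λ : Finset (Fin (n + 4))) : M.baseJump Λ q₂ = 0 := by
  by_cases h : ∃ s, Encodes Λ s
  · obtain ⟨s, h⟩ := h
    rw [M.baseJump_of_encodes h]
    have h1 : ∀ s : Fin (n + 1), stateVec s q₂ = 0 := by
      intro s; unfold stateVec q₂; rw [if_neg]; simp; omega
    have h2 : ∀ o, opVec (n := n) o q₂ = 0 := by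
      intro o; unfold opVec q₂ counterCoord
      refine Finset.sum_eq_zero fun i _ => ?_
      rw [if_neg]; simp only [Fin.mk.injEq]; omega
    simp [h1, h2]
  · rw [M.baseJump_of_not_encodes h]
    unfold decSmallest
    rw [if_neg]
    intro hl
    apply h
    refine ⟨0, fun k => ⟨fun hk => ?_, fun hk => by simp at hk⟩⟩
    have := hl.2 (by exact_mod_cast hk)
    simp only [q₂, stateCoord, Fin.mk_le_mk] at this
    omega

theorem q₂_mainJump (Λ : Finset (Fin (n + 4))) : M.mainJump Λ q₂ = 0 := by
  have : (q₂ : Fin (n + 4)) ≠ q₁ := by simp [q₁, q₂]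
  simp [mainJump, q₂_baseJump, this]

theorem jumpLaw_bounds (hM : M.NoIncrementOnLeaving) (p : ℝ) (h0 : 0 ≤ p) (h1 : p ≤ 1)
    (Λ : Finset (Fin (n + 4))) (Δ : Fin (n + 4) → ℤ) (hΔ : Δ ∈ (M.jumpLaw p h0 h1 Λ).support)
    (i : Fin (n + 4)) : -1 ≤ Δ i ∧ (i ∉ Λ → 0 ≤ Δ i) := by
  have A1 := M.baseJump_ge Λ i
  have A2 := M.mainJump_ge hM Λ i
  have A3 := fun h : i ∉ Λ => M.baseJump_nonneg h
  have A4 := M.q₂_mainJump Λ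
  have main : -1 ≤ M.mainJump Λ i ∧ (i ∉ Λ → 0 ≤ M.mainJump Λ i) :=
    ⟨A1.trans A2, fun h => (A3 h).trans A2⟩
  have hs : ∀ x : ℤ, i ≠ q₂ → (Pi.single q₂ x : Fin (n + 4) → ℤ) i = 0 :=
    fun x hi => by simp [hi]
  have down : q₂ ∈ Λ → -1 ≤ (M.mainJump Λ - Pi.single q₂ 1 : Fin (n + 4) → ℤ) i ∧
      (i ∉ Λ → 0 ≤ (M.mainJump Λ - Pi.single q₂ 1 : Fin (n + 4) → ℤ) i) := by
    intro hq
    by_cases hi : i = q₂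
    · subst hi; simp [A4, hq]
    · simpa [hs 1 hi] using main
  have up : -1 ≤ (M.mainJump Λ + Pi.single q₂ 1 : Fin (n + 4) → ℤ) i ∧
      (i ∉ Λ → 0 ≤ (M.mainJump Λ + Pi.single q₂ 1 : Fin (n + 4) → ℤ) i) := by
    by_cases hi : i = q₂
    · subst hi; simp [A4]
    · simpa [hs 1 hi] using main
  unfold jumpLaw at hΔ
  split_ifs at hΔ with hq hz hne
  · rw [PMF.support_pure, Set.mem_singleton_iff] at hΔ; subst hΔ; exact down hq
  · rw [PMF.support_map] at hΔ
    obtain ⟨b, -, rfl⟩ := hΔ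
    cases b
    · simpa using down hq
    · simpa using main
  · rw [PMF.support_pure, Set.mem_singleton_iff] at hΔ; subst hΔ
    exact ⟨decSmallest_ge Λ i, fun h => (decSmallest_of_notMem h).ge⟩
  · rw [PMF.support_map] at hΔ
    obtain ⟨b, -, rfl⟩ := hΔ
    cases b
    · simpa using main
    · simpa using up

theorem jumpLaw_finite (p : ℝ) (h0 : 0 ≤ p) (h1 : p ≤ 1) (Λ : Finset (Fin (n + 4))) :
    (M.jumpLaw p h0 h1 Λ).support.Finite := by
  unfold jumpLaw
  split_ifs
  · simp
  · rw [PMF.support_map]; exact (Set.toFinite _).image _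
  · simp
  · rw [PMF.support_map]; exact (Set.toFinite _).image _

/-- The random walk `(Q, q₁, q₂)` built from a counter machine and a Bernoulli parameter. -/
def walk (hM : M.NoIncrementOnLeaving) (p : ℝ) (h0 : 0 < p) (h1 : p < 1) :
    ConstrainedWalk (n + 4) where
  jump := M.jumpLaw p h0.le h1.le
  finite_support := M.jumpLaw_finite p h0.le h1.le
  neg_one_le Λ Δ hΔ i := (M.jumpLaw_bounds hM p h0.le h1.le Λ Δ hΔ i).1
  consistent Λ Δ hΔ i hi := (M.jumpLaw_bounds hM p h0.le h1.le Λ Δ hΔ i).2 hi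

/-- The function `∑ Q_i + q₁ + C q₂`. -/
def lyapunovFn (C : ℝ) (q : Fin (n + 4) → ℕ) : ℝ :=
  (∑ k : Fin n, (q (stateCoord k) : ℝ)) + (∑ i : Fin 2, (q (counterCoord i) : ℝ))
    + q q₁ + C * q q₂

end CounterMachine

end

namespace ConstrainedWalk

variable {d : ℕ} (W : ConstrainedWalk d)

/-! ### The Markov property of the trajectory -/

/-! An excursion from the origin is a run of the machine stopped by a random clock. While the clock
`q₂` runs, every step performs one machine update, and `q₁` absorbs the difference so that the norm
of `(Q, q₁)` grows by exactly one. `NoIncrementOnLeaving` bounds the machine's own increase by one,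
so `q₁` never has to decrease. Once `q₂ = 0`, units are removed one at a time until the origin. The
descent therefore lasts as long as the ascent, whatever the machine has computed: if the coin shows
`true` `t` times, there are `t + 1` steps up and `t + 1` steps down. The number `t` is geometric,
except that a return of the machine to `(s_0, 0, 0)` forces the clock to stop and truncates the law
at `T`. The carrying lemmas are `Represents.mainMove` (simulation),
`pathLaw_hittingTime_of_represents` and `pathLaw_returnTime`.

Recurrence uses the drift of `lyapunovFn` and a Foster criterion, `lintegral_hittingTime_le`. With
probability at least `1 - p` a running clock loses a unit, worth `C`, and this pays for the growth
of the norm.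

The stationary law is the normalized occupation measure of an excursion, so its mass at the origin
is the inverse mean return time. It is unique because this measure is the least invariant one with
mass one at the origin (`occupation_mul_le`), and the origin is reachable from every state. All this
rests on the Markov property at time one, `map_shift_pathLaw`. -/

theorem kernel_singleton (q q' : Fin d → ℕ) : W.kernel q {q'} = W.trans q q' := by
  change (W.trans q).toMeasure {q'} = _
  rw [PMF.toMeasure_apply_singleton _ _ (measurableSet_singleton _)]

instance (q : Fin d → ℕ) : IsProbabilityMeasure (W.pathLaw q) := by
  unfold pathLaw; infer_instance

/-- The trajectories that agree with `x` up to the time `n`. -/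
def pathCylinder (n : ℕ) (x : ℕ → Fin d → ℕ) : Set (ℕ → Fin d → ℕ) :=
  {ω | ∀ i ≤ n, ω i = x i}

theorem measurableSet_pathCylinder (n : ℕ) (x : ℕ → Fin d → ℕ) :
    MeasurableSet (pathCylinder n x) := by
  have : pathCylinder n x = ⋂ i ∈ Set.Iic n, (fun ω : ℕ → Fin d → ℕ => ω i) ⁻¹' {x i} := by
    ext ω; simp [pathCylinder]
  rw [this]
  exact MeasurableSet.biInter (Set.to_countable _)
    fun i _ => measurable_pi_apply i (measurableSet_singleton _)

/-- The restriction of a trajectory to the times up to `n`. -/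
abbrev upTo (n : ℕ) : (ℕ → Fin d → ℕ) → Finset.Iic n → Fin d → ℕ :=
  Preorder.frestrictLe (π := fun _ : ℕ => Fin d → ℕ) n

theorem pathCylinder_eq_preimage (n : ℕ) (x : ℕ → Fin d → ℕ) :
    pathCylinder n x = upTo n ⁻¹' {upTo n x} := by
  ext ω
  simp [pathCylinder, funext_iff]

theorem map_upTo_singleton (μ : Measure (ℕ → Fin d → ℕ)) (n : ℕ) (x : ℕ → Fin d → ℕ) :
    μ.map (upTo n) {upTo n x} = μ (pathCylinder n x) := by
  rw [pathCylinder_eq_preimage, Measure.map_apply (Preorder.measurable_frestrictLe n)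
    (measurableSet_singleton _)]

theorem pathLaw_pathCylinder_zero (q : Fin d → ℕ) (x : ℕ → Fin d → ℕ) :
    W.pathLaw q (pathCylinder 0 x) = if q = x 0 then 1 else 0 := by
  rw [← map_upTo_singleton, pathLaw, Kernel.traj_map_frestrictLe_apply,
    Kernel.partialTraj_self, Kernel.id_apply, Measure.dirac_apply' _ (measurableSet_singleton _)]
  simp only [Set.indicator, Set.mem_singleton_iff, Pi.one_apply]
  congr 1
  rw [eq_iff_iff]
  constructor
  · intro h; exact congrFun h ⟨0, by simp⟩
  · intro h; funext i
    obtain ⟨i, hi⟩ := i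
    obtain rfl : i = 0 := by simpa using hi
    exact h

/-- The chain rule for finite prefixes, obtained by unfolding one step of the Ionescu-Tulcea
construction. Since the state space is countable, prefixes are atoms and no densities are needed. -/
theorem pathLaw_pathCylinder_succ (q : Fin d → ℕ) (n : ℕ) (x : ℕ → Fin d → ℕ) :
    W.pathLaw q (pathCylinder (n + 1) x) =
      W.pathLaw q (pathCylinder n x) * W.trans (x n) (x (n + 1)) := by
  rw [← map_upTo_singleton, ← map_upTo_singleton, pathLaw, Kernel.traj_map_frestrictLe_apply,
    Kernel.traj_map_frestrictLe_apply,
    Kernel.partialTraj_succ_of_le (Nat.zero_le n), Kernel.map_apply' _ (by fun_prop) _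
    (measurableSet_singleton _)]
  -- A prefix up to `n + 1` is a prefix up to `n` glued to a last state, so the preimage of an atom
  -- is a rectangle.
  have hpre : (IicProdIoc (X := fun _ => Fin d → ℕ) n (n + 1)) ⁻¹' {upTo (n + 1) x} =
      {upTo n x} ×ˢ ((MeasurableEquiv.piSingleton (X := fun _ => Fin d → ℕ) n).symm ⁻¹'
        {x (n + 1)}) := by
    ext y
    simp only [Set.mem_preimage, Set.mem_singleton_iff, Set.mem_prod]
    constructor
    · intro h
      refine ⟨funext fun i => ?_, ?_⟩
      · have hi := Finset.mem_Iic.1 i.2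
        have := congrFun h ⟨i.1, by simp; omega⟩
        simpa [IicProdIoc, hi] using this
      · have := congrFun h ⟨n + 1, by simp⟩
        simpa [IicProdIoc, MeasurableEquiv.piSingleton] using this
    · rintro ⟨h1, h2⟩
      funext ⟨i, hi⟩
      by_cases hin : i ≤ n
      · have := congrFun h1 ⟨i, by simpa using hin⟩
        simpa [IicProdIoc, hin] using this
      · have hi' := Finset.mem_Iic.1 hi
        obtain rfl : i = n + 1 := by omega
        simpa [IicProdIoc, MeasurableEquiv.piSingleton] using h2
  rw [hpre]
  have hm : MeasurableSet ((MeasurableEquiv.piSingleton (X := fun _ => Fin d → ℕ) n).symm ⁻¹'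
      {x (n + 1)}) := (MeasurableEquiv.measurable _) (measurableSet_singleton _)
  rw [Kernel.comp_apply' _ _ _ ((measurableSet_singleton _).prod hm),
    lintegral_congr (g := ({upTo n x} : Set _).indicator
    fun _ => W.trans (x n) (x (n + 1)))]
  · rw [lintegral_indicator (measurableSet_singleton _), lintegral_const,
      Measure.restrict_apply_univ, mul_comm]
  · intro y
    rw [Kernel.prod_apply, Measure.prod_prod, Kernel.id_apply,
      Measure.dirac_apply' _ (measurableSet_singleton _), Kernel.map_apply' _ (by fun_prop) _ hm]
    by_cases hy : y = upTo n x
    · subst hy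
      simp only [Set.indicator, Set.mem_singleton_iff, if_true, Pi.one_apply, one_mul]
      rw [Kernel.comap_apply, ← Set.preimage_comp]
      simpa using W.kernel_singleton (x n) (x (n + 1))
    · simp [Set.indicator, hy]

/-- Prefixes of a fixed length form a countable space, so atoms determine the prefix marginals;
these determine a finite measure on trajectories as a projective limit. -/
theorem ext_of_pathCylinder {μ ν : Measure (ℕ → Fin d → ℕ)} [IsFiniteMeasure μ]
    [IsFiniteMeasure ν] (h : ∀ n x, μ (pathCylinder n x) = ν (pathCylinder n x)) : μ = ν := by
  have key : ∀ n, μ.map (upTo n) = ν.map (upTo n) := by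
    intro n
    refine Measure.ext_of_singleton fun y => ?_
    obtain ⟨x, rfl⟩ : ∃ x, y = upTo n x := by
      -- The value after time `n` is irrelevant padding.
      refine ⟨fun i => if hi : i ≤ n then y ⟨i, by simpa using hi⟩ else 0, ?_⟩
      funext ⟨i, hi⟩
      simp [Finset.mem_Iic.1 hi]
    rw [map_upTo_singleton, map_upTo_singleton, h]
  refine IsProjectiveLimit.unique (α := fun _ : ℕ => Fin d → ℕ)
    (P := fun I => ν.map I.restrict) (fun I => ?_) fun I => rfl
  have hI : I ⊆ Finset.Iic (I.sup id) := I.subset_Iic_sup_id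
  have : I.restrict (π := fun _ : ℕ => Fin d → ℕ) =
      Finset.restrict₂ (π := fun _ : ℕ => Fin d → ℕ) hI ∘ upTo (I.sup id) := rfl
  change _ = ν.map I.restrict
  rw [this, ← Measure.map_map (by fun_prop) (by fun_prop),
    ← Measure.map_map (by fun_prop) (by fun_prop), key]

/-- The trajectory without its initial state. -/
def shift (ω : ℕ → Fin d → ℕ) : ℕ → Fin d → ℕ := fun t => ω (t + 1)

theorem measurable_shift : Measurable (shift : (ℕ → Fin d → ℕ) → _) :=
  measurable_pi_lambda _ fun t => measurable_pi_apply (t + 1)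

theorem ae_pathLaw_zero (q : Fin d → ℕ) : ∀ᵐ ω ∂W.pathLaw q, ω 0 = q := by
  have h := W.pathLaw_pathCylinder_zero q fun _ => q
  rw [if_pos rfl] at h
  have := (prob_compl_eq_zero_iff (measurableSet_pathCylinder _ _)).2 h
  refine measure_mono_null (fun ω hω => ?_) this
  simpa [pathCylinder] using hω

/-- Almost surely the path starts at `q`, so the shifted cylinder is the cylinder of `x` with `q`
prepended. The induction then peels off the last transition, which is the same factor on both sides.
-/
theorem pathLaw_shift_preimage_pathCylinder (q : Fin d → ℕ) (n : ℕ) (x : ℕ → Fin d → ℕ) :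
    W.pathLaw q (shift ⁻¹' pathCylinder n x) =
      W.trans q (x 0) * W.pathLaw (x 0) (pathCylinder n x) := by
  have h1 : W.pathLaw q (shift ⁻¹' pathCylinder n x) =
      W.pathLaw q (pathCylinder (n + 1) fun t => Nat.casesOn t q x) := by
    refine measure_congr ?_
    filter_upwards [W.ae_pathLaw_zero q] with ω hω
    refine propext ⟨fun h i hi => ?_, fun h i hi => ?_⟩
    · cases i with
      | zero => exact hω
      | succ i => exact h i (by omega)
    · exact h (i + 1) (by omega)
  rw [h1]
  clear h1
  induction n with
  | zero =>
    rw [pathLaw_pathCylinder_succ, pathLaw_pathCylinder_zero, pathLaw_pathCylinder_zero]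
    simp
  | succ n ih =>
    rw [pathLaw_pathCylinder_succ, ih, pathLaw_pathCylinder_succ, mul_assoc]

/-- The Markov property at time one; every first-step recursion below comes from it. On a cylinder
only the summand `q' = x 0` survives. -/
theorem map_shift_pathLaw (q : Fin d → ℕ) :
    (W.pathLaw q).map shift = Measure.sum fun q' => W.trans q q' • W.pathLaw q' := by
  have hfin : IsFiniteMeasure (Measure.sum fun q' => W.trans q q' • W.pathLaw q') := by
    refine ⟨?_⟩
    rw [Measure.sum_apply _ MeasurableSet.univ]
    simp
  have : IsFiniteMeasure ((W.pathLaw q).map shift) := inferInstance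
  refine ext_of_pathCylinder fun n x => ?_
  rw [Measure.map_apply measurable_shift (measurableSet_pathCylinder n x),
    pathLaw_shift_preimage_pathCylinder, Measure.sum_apply _ (measurableSet_pathCylinder n x),
    tsum_eq_single (x 0)]
  · simp
  · intro q' hq'
    have : W.pathLaw q' (pathCylinder n x) = 0 := by
      refine measure_mono_null (t := pathCylinder 0 x) (fun ω hω i hi => hω i (by omega)) ?_
      rw [pathLaw_pathCylinder_zero, if_neg hq']
    simp [this]

theorem pathLaw_shift_preimage (q : Fin d → ℕ) {A : Set (ℕ → Fin d → ℕ)} (hA : MeasurableSet A) :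
    W.pathLaw q (shift ⁻¹' A) = ∑' q', W.trans q q' * W.pathLaw q' A := by
  rw [← Measure.map_apply measurable_shift hA, map_shift_pathLaw, Measure.sum_apply _ hA]
  simp

theorem ae_shift {P : (ℕ → Fin d → ℕ) → Prop} (h : ∀ q, ∀ᵐ ω ∂W.pathLaw q, P ω)
    (q : Fin d → ℕ) : ∀ᵐ ω ∂W.pathLaw q, P (shift ω) := by
  refine ae_of_ae_map measurable_shift.aemeasurable (p := P) ?_
  rw [map_shift_pathLaw, Measure.ae_sum_iff]
  exact fun q' => Measure.ae_smul_measure (h q') _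

end ConstrainedWalk

namespace ConstrainedWalk

variable {d : ℕ} (W : ConstrainedWalk d)

/-! ### Hitting and return times -/

theorem lt_hittingTime_iff {X : Set (Fin d → ℕ)} {ω : ℕ → Fin d → ℕ} {t : ℕ} :
    (t : ℕ∞) < hittingTime X ω ↔ ∀ s ≤ t, ω s ∉ X := by
  rw [← ENat.add_one_le_iff (ENat.natCast_ne_top t), hittingTime, le_iInf₂_iff]
  refine ⟨fun h s hs hX => ?_, fun h s hX => ?_⟩
  · have := h s hX
    norm_cast at this
    omega
  · by_contra hlt
    norm_cast at hlt
    exact h s (by omega) hX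

theorem lt_returnTime_iff {ω : ℕ → Fin d → ℕ} {t : ℕ} :
    (t : ℕ∞) < returnTime ω ↔ ∀ s, 1 ≤ s → s ≤ t → ω s ≠ 0 := by
  rw [← ENat.add_one_le_iff (ENat.natCast_ne_top t), returnTime, le_iInf₂_iff]
  refine ⟨fun h s h1 hs hX => ?_, fun h s hX => ?_⟩
  · have := h s ⟨h1, hX⟩
    norm_cast at this
    omega
  · by_contra hlt
    norm_cast at hlt
    exact h s hX.1 (by omega) hX.2

theorem hittingTime_of_mem {X : Set (Fin d → ℕ)} {ω : ℕ → Fin d → ℕ} (h : ω 0 ∈ X) :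
    hittingTime X ω = 0 := by
  by_contra h0
  exact lt_hittingTime_iff (t := 0).1 (pos_iff_ne_zero.2 h0) 0 le_rfl h

theorem returnTime_eq (ω : ℕ → Fin d → ℕ) :
    returnTime ω = hittingTime {0} (shift ω) + 1 := by
  refine ENat.eq_of_forall_natCast_le_iff fun t => ?_
  obtain _ | t := t
  · simp
  rw [Nat.cast_add, Nat.cast_one, ENat.add_one_le_iff (ENat.natCast_ne_top t),
    ENat.add_le_add_iff_right ENat.one_ne_top, lt_returnTime_iff]
  obtain _ | t := t
  · simp; intro s; omega
  rw [Nat.cast_add, Nat.cast_one, ENat.add_one_le_iff (ENat.natCast_ne_top t),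
    lt_hittingTime_iff]
  refine ⟨fun h s hs => h (s + 1) (by omega) (by omega), fun h s h1 hs => ?_⟩
  obtain ⟨s, rfl⟩ := Nat.exists_eq_add_of_le' h1
  exact h s (by omega)

theorem hittingTime_of_notMem {X : Set (Fin d → ℕ)} {ω : ℕ → Fin d → ℕ} (h : ω 0 ∉ X) :
    hittingTime X ω = hittingTime X (shift ω) + 1 := by
  refine ENat.eq_of_forall_natCast_le_iff fun t => ?_
  obtain _ | t := t
  · simp
  rw [Nat.cast_add, Nat.cast_one, ENat.add_one_le_iff (ENat.natCast_ne_top t),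
    ENat.add_le_add_iff_right ENat.one_ne_top, lt_hittingTime_iff]
  obtain _ | t := t
  · simpa using h
  rw [Nat.cast_add, Nat.cast_one, ENat.add_one_le_iff (ENat.natCast_ne_top t),
    lt_hittingTime_iff]
  refine ⟨fun h s hs => h (s + 1) (by omega), fun h' s hs => ?_⟩
  obtain _ | s := s
  · exact h
  · exact h' s (by omega)

theorem hittingTime_anti {X Y : Set (Fin d → ℕ)} (h : X ⊆ Y) (ω : ℕ → Fin d → ℕ) :
    hittingTime Y ω ≤ hittingTime X ω :=
  le_iInf₂ fun t ht => iInf₂_le t (h ht)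

theorem measurableSet_lt_hittingTime (X : Set (Fin d → ℕ)) (t : ℕ) :
    MeasurableSet {ω : ℕ → Fin d → ℕ | (t : ℕ∞) < hittingTime X ω} := by
  have : {ω : ℕ → Fin d → ℕ | (t : ℕ∞) < hittingTime X ω} =
      ⋂ s ∈ Set.Iic t, (fun ω : ℕ → Fin d → ℕ => ω s) ⁻¹' Xᶜ := by
    ext ω; simp [lt_hittingTime_iff]
  rw [this]
  exact MeasurableSet.biInter (Set.to_countable _)
    fun i _ => measurable_pi_apply i (Set.to_countable _).measurableSet

theorem measurable_hittingTime (X : Set (Fin d → ℕ)) :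
    Measurable (hittingTime X : (ℕ → Fin d → ℕ) → ℕ∞) := by
  refine ENat.measurable_iff.2 fun n => ?_
  have h0 : ∀ n : ℕ, MeasurableSet {ω : ℕ → Fin d → ℕ | (n : ℕ∞) ≤ hittingTime X ω} := by
    rintro (_ | n)
    · simp
    · simpa [ENat.add_one_le_iff] using measurableSet_lt_hittingTime X n
  have : hittingTime X ⁻¹' {(n : ℕ∞)} =
      {ω : ℕ → Fin d → ℕ | (n : ℕ∞) ≤ hittingTime X ω} \ {ω | (n : ℕ∞) < hittingTime X ω} := by
    ext ω
    simp only [Set.mem_preimage, Set.mem_singleton_iff, Set.mem_sdiff, Set.mem_ofPred_eq, not_lt]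
    exact ⟨fun h => ⟨h.ge, h.le⟩, fun h => le_antisymm h.2 h.1⟩
  rw [this]
  exact (h0 n).diff (measurableSet_lt_hittingTime X n)

theorem measurableSet_hittingTime_eq (X : Set (Fin d → ℕ)) (k : ℕ∞) :
    MeasurableSet {ω : ℕ → Fin d → ℕ | hittingTime X ω = k} :=
  measurable_hittingTime X (measurableSet_singleton k)

theorem measurable_returnTime : Measurable (returnTime : (ℕ → Fin d → ℕ) → ℕ∞) := by
  have : (returnTime : (ℕ → Fin d → ℕ) → ℕ∞) = (fun k => k + 1) ∘ hittingTime {0} ∘ shift :=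
    funext returnTime_eq
  rw [this]
  exact (Measurable.of_discrete).comp ((measurable_hittingTime _).comp measurable_shift)

theorem _root_.ENat.toENNReal_eq_tsum (a : ℕ∞) :
    (a : ℝ≥0∞) = ∑' t : ℕ, if (t : ℕ∞) < a then 1 else 0 := by
  induction a using ENat.recTopCoe with
  | top => simp
  | coe n =>
    rw [tsum_eq_sum (s := Finset.range n) (by simp)]
    rw [Finset.sum_congr rfl (g := fun _ => 1)]
    · simp
    · intro t ht; simpa using ht

theorem _root_.MeasureTheory.lintegral_enat_eq_tsum {Ω : Type*} [MeasurableSpace Ω]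
    (μ : Measure Ω) {τ : Ω → ℕ∞} (hτ : Measurable τ) :
    ∫⁻ ω, (τ ω : ℝ≥0∞) ∂μ = ∑' t : ℕ, μ {ω | (t : ℕ∞) < τ ω} := by
  have hm : ∀ t : ℕ, MeasurableSet {ω | (t : ℕ∞) < τ ω} := fun t =>
    hτ (MeasurableSet.of_discrete (s := {a : ℕ∞ | (t : ℕ∞) < a}))
  simp_rw [ENat.toENNReal_eq_tsum]
  rw [lintegral_tsum fun t => (Measurable.ite (hm t) measurable_const
    measurable_const).aemeasurable]
  refine tsum_congr fun t => ?_
  rw [← lintegral_indicator_one (hm t)]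
  simp [Set.indicator]

theorem pathLaw_lt_hittingTime_of_mem {X : Set (Fin d → ℕ)} {q : Fin d → ℕ} (hq : q ∈ X)
    (t : ℕ) : W.pathLaw q {ω | (t : ℕ∞) < hittingTime X ω} = 0 := by
  have : ∀ᵐ ω ∂W.pathLaw q, ¬ ((t : ℕ∞) < hittingTime X ω) := by
    filter_upwards [W.ae_pathLaw_zero q] with ω hω
    simp [hittingTime_of_mem (X := X) (hω ▸ hq)]
  simpa [ae_iff] using this

theorem pathLaw_lt_hittingTime_succ {X : Set (Fin d → ℕ)} {q : Fin d → ℕ} (hq : q ∉ X)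
    (t : ℕ) : W.pathLaw q {ω | ((t + 1 : ℕ) : ℕ∞) < hittingTime X ω} =
      ∑' q', W.trans q q' * W.pathLaw q' {ω | (t : ℕ∞) < hittingTime X ω} := by
  rw [← W.pathLaw_shift_preimage q (measurableSet_lt_hittingTime X t)]
  refine measure_congr (Filter.eventuallyEq_set.2 ?_)
  filter_upwards [W.ae_pathLaw_zero q] with ω hω
  simp only [Set.mem_ofPred_eq, Set.mem_preimage]
  rw [hittingTime_of_notMem (X := X) (hω ▸ hq), Nat.cast_add, Nat.cast_one]
  exact ENat.add_lt_add_iff_right ENat.one_ne_top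

theorem pathLaw_hittingTime_eq_zero {X : Set (Fin d → ℕ)} {q : Fin d → ℕ} (hq : q ∉ X) :
    W.pathLaw q {ω | hittingTime X ω = 0} = 0 := by
  have : ∀ᵐ ω ∂W.pathLaw q, ¬ hittingTime X ω = 0 := by
    filter_upwards [W.ae_pathLaw_zero q] with ω hω
    simp [hittingTime_of_notMem (X := X) (hω ▸ hq)]
  simpa [ae_iff] using this

theorem pathLaw_hittingTime_eq_of_mem {X : Set (Fin d → ℕ)} {q : Fin d → ℕ} (hq : q ∈ X)
    (k : ℕ∞) : W.pathLaw q {ω | hittingTime X ω = k} = if k = 0 then 1 else 0 := by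
  have : W.pathLaw q {ω | hittingTime X ω = k} = W.pathLaw q {ω | 0 = k} := by
    refine measure_congr (Filter.eventuallyEq_set.2 ?_)
    filter_upwards [W.ae_pathLaw_zero q] with ω hω
    rw [hittingTime_of_mem (X := X) (hω ▸ hq)]
  rw [this]
  split_ifs with hk
  · simp [hk]
  · simp [Ne.symm hk]

theorem pathLaw_hittingTime_eq_succ {X : Set (Fin d → ℕ)} {q : Fin d → ℕ} (hq : q ∉ X)
    (k : ℕ) : W.pathLaw q {ω | hittingTime X ω = ((k + 1 : ℕ) : ℕ∞)} =
      ∑' q', W.trans q q' * W.pathLaw q' {ω | hittingTime X ω = (k : ℕ∞)} := by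
  rw [← W.pathLaw_shift_preimage q (measurableSet_hittingTime_eq X k)]
  refine measure_congr (Filter.eventuallyEq_set.2 ?_)
  filter_upwards [W.ae_pathLaw_zero q] with ω hω
  simp only [Set.mem_ofPred_eq, Set.mem_preimage]
  rw [hittingTime_of_notMem (X := X) (hω ▸ hq), Nat.cast_add, Nat.cast_one]
  exact WithTop.add_right_inj ENat.one_ne_top

theorem pathLaw_returnTime_eq_succ (q : Fin d → ℕ) (k : ℕ) :
    W.pathLaw q {ω | returnTime ω = ((k + 1 : ℕ) : ℕ∞)} =
      ∑' q', W.trans q q' * W.pathLaw q' {ω | hittingTime {0} ω = (k : ℕ∞)} := by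
  rw [← W.pathLaw_shift_preimage q (measurableSet_hittingTime_eq _ k)]
  congr 1
  ext ω
  simp only [Set.mem_ofPred_eq, Set.mem_preimage]
  rw [returnTime_eq, Nat.cast_add, Nat.cast_one]
  exact WithTop.add_right_inj ENat.one_ne_top

/-! ### The drift criterion -/

/-- Foster's criterion without martingales: the mean is the sum of the tails, and each partial sum
of tails is bounded by `V`, by induction on its length with the initial state varying. -/
theorem lintegral_hittingTime_le (X : Set (Fin d → ℕ)) (V : (Fin d → ℕ) → ℝ≥0∞)
    (hV : ∀ q ∉ X, 1 + ∑' q', W.trans q q' * V q' ≤ V q) (q : Fin d → ℕ) :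
    ∫⁻ ω, (hittingTime X ω : ℝ≥0∞) ∂W.pathLaw q ≤ V q := by
  rw [lintegral_enat_eq_tsum _ (measurable_hittingTime X), ENNReal.tsum_eq_iSup_nat]
  refine iSup_le fun T => ?_
  induction T generalizing q with
  | zero => simp
  | succ T ih =>
    by_cases hq : q ∈ X
    · simp [W.pathLaw_lt_hittingTime_of_mem hq]
    · refine le_trans ?_ (hV q hq)
      -- The tail at time zero is at most the `1` in the drift condition; the others are tails from
      -- the next state, one step shorter.
      rw [Finset.sum_range_succ', add_comm]
      refine add_le_add prob_le_one ?_
      simp_rw [W.pathLaw_lt_hittingTime_succ hq]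
      rw [← Summable.tsum_finsetSum fun _ _ => ENNReal.summable]
      refine ENNReal.tsum_le_tsum fun q' => ?_
      rw [← Finset.mul_sum]
      exact mul_le_mul_right (ih q') _

theorem ae_frequently_mem {X : Set (Fin d → ℕ)}
    (h : ∀ q, ∀ᵐ ω ∂W.pathLaw q, ∃ t, ω t ∈ X) (q : Fin d → ℕ) :
    ∀ᵐ ω ∂W.pathLaw q, ∃ᶠ t in Filter.atTop, ω t ∈ X := by
  have key : ∀ s : ℕ, ∀ q, ∀ᵐ ω ∂W.pathLaw q, ∃ t ≥ s, ω t ∈ X := by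
    intro s
    induction s with
    | zero => simpa using h
    | succ s ih =>
      intro q
      filter_upwards [W.ae_shift ih q] with ω ⟨t, hts, ht⟩
      exact ⟨t + 1, by omega, ht⟩
  simp_rw [Filter.frequently_atTop]
  exact ae_all_iff.2 fun s => key s q

/-- The ball of radius one contains the origin, so it is hit no later; finite mean hitting times
from all states give infinitely many visits by restarting. -/
theorem positiveRecurrent_of_drift (V : (Fin d → ℕ) → ℝ≥0∞) (hfin : ∀ q, V q ≠ ∞)
    (hV : ∀ q ≠ 0, 1 + ∑' q', W.trans q q' * V q' ≤ V q) : W.PositiveRecurrent := by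
  have hsub : ({0} : Set (Fin d → ℕ)) ⊆ {z | ∑ i, (z i : ℝ) ≤ 1} := by
    rintro _ rfl; simp
  have hle : ∀ q, ∫⁻ ω, (hittingTime {0} ω : ℝ≥0∞) ∂W.pathLaw q < ∞ := fun q =>
    (W.lintegral_hittingTime_le {0} V (by simpa using hV) q).trans_lt (hfin q).lt_top
  refine ⟨1, one_pos, fun q => ⟨W.ae_frequently_mem (fun q => ?_) q, ?_⟩⟩
  · have hm : Measurable fun ω : ℕ → Fin d → ℕ => (hittingTime {0} ω : ℝ≥0∞) :=
      (Measurable.of_discrete (f := ENat.toENNReal)).comp (measurable_hittingTime _)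
    filter_upwards [ae_lt_top hm (hle q).ne] with ω hω
    by_contra hne
    push Not at hne
    have : hittingTime {0} ω = ⊤ := by
      refine ENat.eq_top_iff_forall_gt.2 fun t => lt_hittingTime_iff.2 fun s _ hs => ?_
      exact absurd (hsub hs) (not_le.2 (hne s))
    simp [this] at hω
  · exact (lintegral_mono fun ω => ENat.toENNReal_le.2 (hittingTime_anti hsub ω)).trans_lt (hle q)

/-! ### The stationary distribution -/

theorem nStep_succ_apply (t : ℕ) (q q' : Fin d → ℕ) :
    W.nStep (t + 1) q q' = ∑' r, W.nStep t q r * W.trans r q' := PMF.bind_apply _ _ _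

theorem tsum_mul_nStep {l : (Fin d → ℕ) → ℝ≥0∞} (hl : ∀ q, ∑' q', l q' * W.trans q' q = l q)
    (t : ℕ) (q : Fin d → ℕ) : ∑' q', l q' * W.nStep t q' q = l q := by
  induction t generalizing q with
  | zero =>
    rw [tsum_eq_single q]
    · simp [nStep]
    · intro q' hq'; simp [nStep, PMF.pure_apply, hq'.symm]
  | succ t ih =>
    simp_rw [nStep_succ_apply, ← ENNReal.tsum_mul_left]
    rw [ENNReal.tsum_comm]
    simp_rw [← mul_assoc, ENNReal.tsum_mul_right, ih, hl]

theorem nStep_add (s t : ℕ) (q : Fin d → ℕ) :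
    W.nStep (s + t) q = (W.nStep s q).bind (W.nStep t) := by
  induction t with
  | zero => simp [nStep]
  | succ t ih => rw [← add_assoc, nStep, ih, PMF.bind_bind]; rfl

theorem nStep_add_pos {s t : ℕ} {q r q' : Fin d → ℕ} (h : 0 < W.nStep s q r)
    (h' : 0 < W.nStep t r q') : 0 < W.nStep (s + t) q q' := by
  rw [nStep_add, PMF.bind_apply]
  exact (ENNReal.mul_pos h.ne' h'.ne').trans_le (ENNReal.le_tsum r)

theorem CommunicatesWithZero.irreducible {W : ConstrainedWalk d} (h : W.CommunicatesWithZero) :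
    W.Irreducible := by
  rintro q q' ⟨s, hs⟩
  obtain ⟨t, ht⟩ := h q
  exact ⟨t + s, W.nStep_add_pos ht hs⟩

/-- `W.taboo t q` is the probability that the walk started at the origin is at `q` at the time `t`
without having returned to the origin. -/
noncomputable def taboo : ℕ → (Fin d → ℕ) → ℝ≥0∞
  | 0, q => if q = 0 then 1 else 0
  | t + 1, q => if q = 0 then 0 else ∑' q', taboo t q' * W.trans q' q

/-- The expected number of visits of `q` before the first return to the origin. -/
noncomputable def occupation (q : Fin d → ℕ) : ℝ≥0∞ := ∑' t, W.taboo t q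

theorem pathLaw_lt_returnTime_zero (q : Fin d → ℕ) :
    W.pathLaw q {ω | ((0 : ℕ) : ℕ∞) < returnTime ω} = 1 := by
  have : {ω : ℕ → Fin d → ℕ | ((0 : ℕ) : ℕ∞) < returnTime ω} = Set.univ := by
    ext ω; simp [returnTime_eq]
  rw [this, measure_univ]

theorem pathLaw_lt_returnTime_succ (q : Fin d → ℕ) (t : ℕ) :
    W.pathLaw q {ω | ((t + 1 : ℕ) : ℕ∞) < returnTime ω} =
      ∑' q', W.trans q q' * if q' = 0 then 0 else W.pathLaw q' {ω | (t : ℕ∞) < returnTime ω} := by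
  have h1 : {ω : ℕ → Fin d → ℕ | ((t + 1 : ℕ) : ℕ∞) < returnTime ω} =
      shift ⁻¹' {ω | (t : ℕ∞) < hittingTime {0} ω} := by
    ext ω
    simp only [Set.mem_ofPred_eq, Set.mem_preimage]
    rw [returnTime_eq, Nat.cast_add, Nat.cast_one]
    exact ENat.add_lt_add_iff_right ENat.one_ne_top
  rw [h1, W.pathLaw_shift_preimage q (measurableSet_lt_hittingTime _ t)]
  refine tsum_congr fun q' => ?_
  congr 1
  split_ifs with h
  -- At the origin the hitting time is zero while the return time is positive, hence the separate
  -- case.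
  · exact W.pathLaw_lt_hittingTime_of_mem (X := {0}) h t
  · refine measure_congr (Filter.eventuallyEq_set.2 ?_)
    filter_upwards [W.ae_pathLaw_zero q'] with ω hω
    rw [hittingTime_of_notMem (by simpa [hω] using h), returnTime_eq]

/-- Survival for `t + s` steps, split at time `t`. The induction moves one transition from the taboo
factor to the tail factor; `s = 0` gives the total mass of `taboo t`. -/
theorem tsum_taboo_mul (t s : ℕ) :
    ∑' q, W.taboo t q * W.pathLaw q {ω | (s : ℕ∞) < returnTime ω} =
      W.pathLaw 0 {ω | ((t + s : ℕ) : ℕ∞) < returnTime ω} := by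
  induction t generalizing s with
  | zero =>
    rw [tsum_eq_single 0]
    · simp [taboo]
    · intro q hq; simp [taboo, hq]
  | succ t ih =>
    rw [show t + 1 + s = t + (s + 1) by ring, ← ih]
    simp_rw [pathLaw_lt_returnTime_succ, ← ENNReal.tsum_mul_left]
    rw [ENNReal.tsum_comm]
    refine tsum_congr fun q => ?_
    simp_rw [← mul_assoc, ENNReal.tsum_mul_right, taboo]
    split_ifs <;> simp

theorem tsum_occupation :
    ∑' q, W.occupation q = ∫⁻ ω, (returnTime ω : ℝ≥0∞) ∂W.pathLaw 0 := by
  rw [lintegral_enat_eq_tsum _ measurable_returnTime]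
  simp_rw [occupation]
  rw [ENNReal.tsum_comm]
  refine tsum_congr fun t => ?_
  have := W.tsum_taboo_mul t 0
  simp_rw [pathLaw_lt_returnTime_zero, mul_one, add_zero] at this
  exact this

theorem occupation_zero : W.occupation 0 = 1 := by
  rw [occupation, tsum_eq_single 0]
  · simp [taboo]
  · rintro (_ | t) ht
    · exact absurd rfl ht
    · simp [taboo]

/-- Away from the origin a transition carries `taboo t` to `taboo (t + 1)`, and the lost term `taboo
0` vanishes. -/
theorem occupation_of_ne_zero {q : Fin d → ℕ} (hq : q ≠ 0) :
    ∑' q', W.occupation q' * W.trans q' q = W.occupation q := by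
  simp_rw [occupation, ← ENNReal.tsum_mul_right]
  rw [ENNReal.tsum_comm, tsum_eq_zero_add' (f := fun t => W.taboo t q) ENNReal.summable]
  simp [taboo, hq]

theorem tsum_tsum_mul_trans (l : (Fin d → ℕ) → ℝ≥0∞) :
    ∑' q, ∑' q', l q' * W.trans q' q = ∑' q, l q := by
  rw [ENNReal.tsum_comm]
  simp_rw [ENNReal.tsum_mul_left, PMF.tsum_coe, mul_one]

theorem _root_.ENNReal.eq_of_tsum_eq_of_forall_ne {ι : Type*} {f g : ι → ℝ≥0∞} {b : ι}
    (h : ∑' i, f i = ∑' i, g i) (hg : ∑' i, g i ≠ ∞) (hne : ∀ i ≠ b, f i = g i) :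
    f b = g b := by
  classical
  have heq : (∑' i, if i = b then 0 else f i) = ∑' i, if i = b then 0 else g i :=
    tsum_congr fun i => by split_ifs with hi <;> simp [hne, hi]
  rw [ENNReal.tsum_eq_add_tsum_ite b, heq] at h
  rw [ENNReal.tsum_eq_add_tsum_ite (f := g) b] at h hg
  exact (ENNReal.add_left_inj (ENNReal.add_ne_top.1 hg).2).1 h

/-- The taboo recursion says nothing about the balance at the origin. Conservation of mass supplies
it: both sides have the same finite total and agree elsewhere. -/
theorem occupation_invariant (h : ∫⁻ ω, (returnTime ω : ℝ≥0∞) ∂W.pathLaw 0 ≠ ∞)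
    (q : Fin d → ℕ) : ∑' q', W.occupation q' * W.trans q' q = W.occupation q := by
  by_cases hq : q = 0
  · subst hq
    have h1 := W.tsum_tsum_mul_trans W.occupation
    refine ENNReal.eq_of_tsum_eq_of_forall_ne h1 (W.tsum_occupation ▸ h) fun q hq => ?_
    exact W.occupation_of_ne_zero hq
  · exact W.occupation_of_ne_zero hq

/-- Minimality: an invariant `l` dominates what its mass at the origin produces in the first `T`
steps before a return, by induction on `T`. -/
theorem occupation_mul_le {l : (Fin d → ℕ) → ℝ≥0∞}
    (hl : ∀ q, ∑' q', l q' * W.trans q' q = l q) (q : Fin d → ℕ) :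
    l 0 * W.occupation q ≤ l q := by
  rw [occupation, ENNReal.tsum_eq_iSup_nat, ENNReal.mul_iSup]
  refine iSup_le fun T => ?_
  induction T generalizing q with
  | zero => simp
  | succ T ih =>
    rw [Finset.sum_range_succ']
    by_cases hq : q = 0
    · subst hq; simp [taboo]
    · simp only [taboo, hq, if_false, add_zero]
      rw [← Summable.tsum_finsetSum fun _ _ => ENNReal.summable, ← ENNReal.tsum_mul_left, ← hl q]
      refine ENNReal.tsum_le_tsum fun q' => ?_
      rw [← Finset.sum_mul, ← mul_assoc]
      exact mul_le_mul_left (ih q') _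

theorem exists_unique_stationary (hc : W.CommunicatesWithZero)
    (h : ∫⁻ ω, (returnTime ω : ℝ≥0∞) ∂W.pathLaw 0 ≠ ∞) :
    ∃ π : PMF (Fin d → ℕ), W.IsStationary π ∧ (∀ π', W.IsStationary π' → π' = π) ∧
      π 0 = (∫⁻ ω, (returnTime ω : ℝ≥0∞) ∂W.pathLaw 0)⁻¹ := by
  have hs := W.tsum_occupation
  set m := ∫⁻ ω, (returnTime ω : ℝ≥0∞) ∂W.pathLaw 0 with hm
  have hm0 : m ≠ 0 := by
    rw [← hs]
    intro h0
    have := ENNReal.tsum_eq_zero.1 h0 0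
    simp [occupation_zero] at this
  have hfin : ∀ q, W.occupation q ≠ ∞ := fun q =>
    ne_top_of_le_ne_top (hs ▸ h) (ENNReal.le_tsum q)
  refine ⟨PMF.normalize W.occupation (hs ▸ hm0) (hs ▸ h), fun q => ?_, fun π' hπ' => ?_, ?_⟩
  · simp_rw [PMF.normalize_apply, mul_right_comm _ _ (W.trans _ _), ENNReal.tsum_mul_right]
    rw [W.occupation_invariant h]
  · have hle := W.occupation_mul_le hπ'
    have hf : ∀ q, π' 0 * W.occupation q ≠ ∞ := fun q =>
      ne_top_of_le_ne_top (PMF.apply_ne_top _ _) (hle q)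
    have hadd : ∀ q, (π' q - π' 0 * W.occupation q) + π' 0 * W.occupation q = π' q :=
      fun q => tsub_add_cancel_of_le (hle q)
    -- The excess of `π'` over its minimal part is invariant too; the finite subtrahend is added
    -- back to avoid truncated subtraction.
    have hinv : ∀ q, ∑' q', (π' q' - π' 0 * W.occupation q') * W.trans q' q =
        π' q - π' 0 * W.occupation q := by
      intro q
      refine (ENNReal.add_left_inj (hf q)).1 ?_
      rw [hadd, ← hπ' q]
      conv_lhs => rw [← W.occupation_invariant h q, ← ENNReal.tsum_mul_left, ← ENNReal.tsum_add]
      refine tsum_congr fun q' => ?_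
      rw [← mul_assoc, ← add_mul, hadd]
    have heq : ∀ q, π' q = π' 0 * W.occupation q := by
      intro q
      obtain ⟨t, ht⟩ := hc q
      -- The excess vanishes at the origin, so it vanishes at every state from which the origin is
      -- reached in `t` steps.
      have h0 := W.tsum_mul_nStep hinv t 0
      rw [occupation_zero, mul_one, tsub_self] at h0
      have := (mul_eq_zero.1 (ENNReal.tsum_eq_zero.1 h0 q)).resolve_right ht.ne'
      exact le_antisymm (tsub_eq_zero_iff_le.1 this) (hle q)
    have hone : π' 0 * m = 1 := by
      rw [← hs, ← ENNReal.tsum_mul_left, ← π'.tsum_coe]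
      exact tsum_congr fun q => (heq q).symm
    ext q
    rw [PMF.normalize_apply, hs, heq, ENNReal.eq_inv_of_mul_eq_one_left hone, mul_comm]
  · rw [PMF.normalize_apply, occupation_zero, one_mul, hs]

end ConstrainedWalk

namespace CounterMachine

variable {n : ℕ} (M : CounterMachine n)

open ConstrainedWalk

/-! ### The coordinates of the lattice -/

theorem coord_cases (c : Fin (n + 4)) :
    (∃ k, c = stateCoord k) ∨ (∃ i, c = counterCoord i) ∨ c = q₁ ∨ c = q₂ := by
  by_cases h1 : (c : ℕ) < n
  · exact Or.inl ⟨⟨c, h1⟩, rfl⟩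
  by_cases h2 : (c : ℕ) < n + 2
  · exact Or.inr (Or.inl ⟨⟨c - n, by omega⟩, Fin.ext (by simp [counterCoord]; omega)⟩)
  have := c.2
  simp only [Fin.ext_iff, q₁, q₂]
  omega

theorem sum_coord {R : Type*} [AddCommMonoid R] (f : Fin (n + 4) → R) :
    ∑ c, f c = (∑ k : Fin n, f (stateCoord k)) + (∑ i : Fin 2, f (counterCoord i))
      + f q₁ + f q₂ := by
  rw [Fin.sum_univ_castSucc, Fin.sum_univ_castSucc, Fin.sum_univ_castSucc,
    Fin.sum_univ_castSucc, Fin.sum_univ_two, ← add_assoc (∑ k : Fin n, f (stateCoord k))]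
  rfl

theorem stateCoord_ne_q₁ (k : Fin n) : stateCoord k ≠ q₁ := by
  simp only [stateCoord, q₁, ne_eq, Fin.mk.injEq]; omega

theorem stateCoord_ne_q₂ (k : Fin n) : stateCoord k ≠ q₂ := by
  simp only [stateCoord, q₂, ne_eq, Fin.mk.injEq]; omega

theorem counterCoord_ne_q₁ (i : Fin 2) : (counterCoord i : Fin (n + 4)) ≠ q₁ := by
  simp only [counterCoord, q₁, ne_eq, Fin.mk.injEq]; omega

theorem counterCoord_ne_q₂ (i : Fin 2) : (counterCoord i : Fin (n + 4)) ≠ q₂ := by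
  simp only [counterCoord, q₂, ne_eq, Fin.mk.injEq]; omega

theorem mem_face {d : ℕ} {q : Fin d → ℕ} {c : Fin d} : c ∈ face q ↔ 0 < q c := by
  simp [face]

/-! ### The moves of the walk -/

/-- The move of `(Q, q₁)`, with `q₂` unchanged. -/
noncomputable def mainMove (q : Fin (n + 4) → ℕ) : Fin (n + 4) → ℕ :=
  fun i => ((q i : ℤ) + M.mainJump (face q) i).toNat

/-- The unit decrement of the smallest positive coordinate. -/
noncomputable def downMove (q : Fin (n + 4) → ℕ) : Fin (n + 4) → ℕ :=
  fun i => ((q i : ℤ) + decSmallest (face q) i).toNat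

open Classical in
/-- The state after one step from `q` as a function of the coin. -/
noncomputable def next (q : Fin (n + 4) → ℕ) (b : Bool) : Fin (n + 4) → ℕ :=
  if 0 < q q₂ then
    if ∀ c, 0 < q c → c = q₁ ∨ c = q₂ then M.mainMove q - Pi.single q₂ 1
    else if b then M.mainMove q else M.mainMove q - Pi.single q₂ 1
  else if q ≠ 0 then downMove q
  else if b then M.mainMove q + Pi.single q₂ 1 else M.mainMove q

theorem mainMove_q₂ (q : Fin (n + 4) → ℕ) : M.mainMove q q₂ = q q₂ := by
  simp [mainMove, q₂_mainJump]

theorem move_sub_single (q : Fin (n + 4) → ℕ) :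
    (fun i => ((q i : ℤ) + (M.mainJump (face q) - Pi.single q₂ 1 : Fin (n + 4) → ℤ) i).toNat) =
      M.mainMove q - Pi.single q₂ 1 := by
  funext i
  simp only [mainMove, Pi.sub_apply]
  by_cases h : i = q₂
  · subst h; simp; omega
  · simp [h]

theorem move_add_single (q : Fin (n + 4) → ℕ) :
    (fun i => ((q i : ℤ) + (M.mainJump (face q) + Pi.single q₂ 1 : Fin (n + 4) → ℤ) i).toNat) =
      M.mainMove q + Pi.single q₂ 1 := by
  funext i
  simp only [mainMove, Pi.add_apply]
  by_cases h : i = q₂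
  · subst h; simp [q₂_mainJump]
  · simp [h]

section

variable (hM : M.NoIncrementOnLeaving) (p : ℝ) (h0 : 0 < p) (h1 : p < 1)

/-- One coin drives all faces: a deterministic step is a function that ignores the coin. Every
expectation thus becomes a two-term sum. -/
theorem walk_trans (q : Fin (n + 4) → ℕ) :
    (M.walk hM p h0 h1).trans q = (coin p h0.le h1.le).map (M.next q) := by
  have hne : (face q).Nonempty ↔ q ≠ 0 := by
    simp only [Finset.Nonempty, mem_face, Nat.pos_iff_ne_zero, ne_eq, funext_iff, not_forall,
      Pi.zero_apply]
  unfold ConstrainedWalk.trans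
  simp only [walk, jumpLaw, mem_face, hne]
  by_cases hq : 0 < q q₂
  · by_cases hz : ∀ c, 0 < q c → c = q₁ ∨ c = q₂
    · rw [if_pos hq, if_pos hz, PMF.pure_map, M.move_sub_single, ← PMF.map_const]
      congr 1
      funext b
      simp only [Function.const, next, if_pos hq, if_pos hz]
    · rw [if_pos hq, if_neg hz, PMF.map_comp]
      congr 1
      funext b
      simp only [next, if_pos hq, if_neg hz, Function.comp]
      cases b
      · simpa using M.move_sub_single q
      · rfl
  · by_cases hz : q ≠ 0
    · rw [if_neg hq, if_pos hz, PMF.pure_map, ← PMF.map_const]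
      congr 1
      funext b
      simp only [Function.const, next, if_neg hq, if_pos hz]
      rfl
    · rw [if_neg hq, if_neg hz, PMF.map_comp]
      congr 1
      funext b
      simp only [next, if_neg hq, if_neg hz, Function.comp]
      cases b
      · rfl
      · simpa using M.move_add_single q

theorem walk_trans_apply (q q' : Fin (n + 4) → ℕ) :
    (M.walk hM p h0 h1).trans q q' =
      (if q' = M.next q true then ENNReal.ofReal p else 0) +
        if q' = M.next q false then ENNReal.ofReal (1 - p) else 0 := by
  rw [walk_trans, PMF.map_apply, tsum_bool, add_comm]
  simp only [coin, PMF.ofFintype_apply, if_true, Bool.false_eq_true, if_false]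
  congr

theorem tsum_trans_mul (q : Fin (n + 4) → ℕ) (F : (Fin (n + 4) → ℕ) → ℝ≥0∞) :
    ∑' q', (M.walk hM p h0 h1).trans q q' * F q' =
      ENNReal.ofReal p * F (M.next q true) + ENNReal.ofReal (1 - p) * F (M.next q false) := by
  simp_rw [walk_trans_apply, add_mul, ite_mul, zero_mul]
  rw [ENNReal.tsum_add]
  congr 1
  · rw [tsum_eq_single (M.next q true) (fun q' h => if_neg h), if_pos rfl]
  · rw [tsum_eq_single (M.next q false) (fun q' h => if_neg h), if_pos rfl]

theorem hasSum_mul_trans (q : Fin (n + 4) → ℕ) (F : (Fin (n + 4) → ℕ) → ℝ) :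
    HasSum (fun q' => F q' * ((M.walk hM p h0 h1).trans q q').toReal)
      (p * F (M.next q true) + (1 - p) * F (M.next q false)) := by
  have h : (fun q' => F q' * ((M.walk hM p h0 h1).trans q q').toReal) = fun q' =>
      (if q' = M.next q true then p * F q' else 0) +
        if q' = M.next q false then (1 - p) * F q' else 0 := by
    funext q'
    rw [walk_trans_apply, ENNReal.toReal_add (by split_ifs <;> simp) (by split_ifs <;> simp),
      mul_add]
    congr 1 <;> split_ifs <;>
      simp [ENNReal.toReal_ofReal, h0.le, h1.le, sub_nonneg, mul_comm]
  rw [h]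
  refine HasSum.add ?_ ?_
  · have := hasSum_single (f := fun q' => if q' = M.next q true then p * F q' else 0)
      (M.next q true) fun q' h => if_neg h
    simpa using this
  · have := hasSum_single (f := fun q' => if q' = M.next q false then (1 - p) * F q' else 0)
      (M.next q false) fun q' h => if_neg h
    simpa using this

include h0 h1 in
theorem ofReal_mul_add_ofReal_mul (x : ℝ≥0∞) :
    ENNReal.ofReal p * x + ENNReal.ofReal (1 - p) * x = x := by
  rw [← add_mul, ← ENNReal.ofReal_add h0.le (sub_pos.2 h1).le]
  simp

end

/-! ### The norm of the state -/

/-- `mainJump` sums to one by the choice of the `q₁` increment; the point to check is that `toNat`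
never truncates. -/
theorem sum_mainMove (hM : M.NoIncrementOnLeaving) (q : Fin (n + 4) → ℕ) :
    ∑ c, M.mainMove q c = ∑ c, q c + 1 := by
  have hc : ∀ c, (M.mainMove q c : ℤ) = q c + M.mainJump (face q) c := by
    intro c
    refine Int.toNat_of_nonneg ?_
    have h1 := M.mainJump_ge hM (face q) c
    by_cases h : c ∈ face q
    · have h2 := M.baseJump_ge (face q) c
      have := mem_face.1 h
      omega
    · have := M.baseJump_nonneg h
      omega
  zify
  simp_rw [hc, Finset.sum_add_distrib]
  simp [mainJump, Finset.sum_add_distrib]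

theorem sum_sub_single {q : Fin (n + 4) → ℕ} (h : 0 < q q₂) :
    ∑ c, (q - Pi.single q₂ 1 : Fin (n + 4) → ℕ) c + 1 = ∑ c, q c := by
  have : q = (q - Pi.single q₂ 1) + Pi.single q₂ 1 := by
    funext c
    by_cases hc : c = q₂
    · subst hc; simp; omega
    · simp [hc]
  conv_rhs => rw [this]
  simp [Finset.sum_add_distrib]

theorem downMove_add_single {q : Fin (n + 4) → ℕ} (h : q ≠ 0) :
    ∃ c, downMove q + Pi.single c 1 = q := by
  have hne : (face q).Nonempty := by
    obtain ⟨c, hc⟩ := Function.ne_iff.1 h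
    exact ⟨c, mem_face.2 (Nat.pos_of_ne_zero hc)⟩
  have hl := (face q).isLeast_min' hne
  refine ⟨(face q).min' hne, funext fun c => ?_⟩
  simp only [downMove, decSmallest, Pi.add_apply, Pi.single_apply]
  by_cases hc : c = (face q).min' hne
  · have := mem_face.1 ((face q).min'_mem hne)
    rw [if_pos (hc ▸ hl), if_pos hc, hc]
    omega
  · rw [if_neg fun h => hc (h.unique hl), if_neg hc]
    omega

theorem sum_downMove {q : Fin (n + 4) → ℕ} (h : q ≠ 0) : ∑ c, downMove q c + 1 = ∑ c, q c := by
  obtain ⟨c, hc⟩ := downMove_add_single h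
  conv_rhs => rw [← hc]
  simp [Finset.sum_add_distrib]

theorem downMove_q₂ {q : Fin (n + 4) → ℕ} (h : q q₂ = 0) : downMove q q₂ = 0 := by
  simp [downMove, decSmallest_of_notMem (c := q₂) (Λ := face q) (by simp [mem_face, h]), h]

theorem next_of_q₂_eq_zero {q : Fin (n + 4) → ℕ} (h : q q₂ = 0) (hq : q ≠ 0) (b : Bool) :
    M.next q b = downMove q := by
  simp [next, h, hq]

theorem next_of_base_eq_zero {q : Fin (n + 4) → ℕ} (h : 0 < q q₂)
    (hq : ∀ c, 0 < q c → c = q₁ ∨ c = q₂) (b : Bool) :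
    M.next q b = M.mainMove q - Pi.single q₂ 1 := by
  rw [next, if_pos h, if_pos hq]

theorem next_true {q : Fin (n + 4) → ℕ} (h : 0 < q q₂)
    (hq : ¬ ∀ c, 0 < q c → c = q₁ ∨ c = q₂) : M.next q true = M.mainMove q := by
  rw [next, if_pos h, if_neg hq, if_pos rfl]

theorem next_false {q : Fin (n + 4) → ℕ} (h : 0 < q q₂) :
    M.next q false = M.mainMove q - Pi.single q₂ 1 := by
  rw [next, if_pos h]
  split_ifs <;> simp_all

theorem next_zero (b : Bool) :
    M.next 0 b = if b then M.mainMove 0 + Pi.single q₂ 1 else M.mainMove 0 := by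
  simp [next]

theorem sum_mainMove_sub_single (hM : M.NoIncrementOnLeaving) {q : Fin (n + 4) → ℕ}
    (h : 0 < q q₂) : ∑ c, (M.mainMove q - Pi.single q₂ 1 : Fin (n + 4) → ℕ) c = ∑ c, q c := by
  have h1 := sum_sub_single (q := M.mainMove q) (by rwa [mainMove_q₂])
  have h2 := M.sum_mainMove hM q
  omega

theorem mainMove_sub_single_q₂ (q : Fin (n + 4) → ℕ) :
    (M.mainMove q - Pi.single q₂ 1 : Fin (n + 4) → ℕ) q₂ = q q₂ - 1 := by
  simp [mainMove_q₂]

theorem le_sum_next (hM : M.NoIncrementOnLeaving) (q : Fin (n + 4) → ℕ) (b : Bool) :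
    ∑ c, q c ≤ ∑ c, M.next q b c + 1 := by
  have hm := M.sum_mainMove hM q
  by_cases hq : 0 < q q₂
  · have hs := M.sum_mainMove_sub_single hM hq
    by_cases hz : ∀ c, 0 < q c → c = q₁ ∨ c = q₂
    · rw [M.next_of_base_eq_zero hq hz]; omega
    · cases b
      · rw [M.next_false hq]; omega
      · rw [M.next_true hq hz]; omega
  · by_cases hz : q = 0
    · subst hz; simp
    · rw [M.next_of_q₂_eq_zero (by omega) hz, sum_downMove hz]

section

variable (hM : M.NoIncrementOnLeaving) (p : ℝ) (h0 : 0 < p) (h1 : p < 1)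

/-! ### Drift and communication -/

theorem lyapunovFn_eq (C : ℝ) (q : Fin (n + 4) → ℕ) :
    lyapunovFn C q = ((∑ c, q c : ℕ) : ℝ) + (C - 1) * q q₂ := by
  rw [sum_coord, lyapunovFn]
  push_cast
  ring

theorem lyapunovFn_nonneg {C : ℝ} (hC : 0 ≤ C) (q : Fin (n + 4) → ℕ) : 0 ≤ lyapunovFn C q := by
  unfold lyapunovFn; positivity

include hM h0 h1 in
-- With the coin in play, the drift is `p - (1 - p) * (C - 1) = 1 - C * (1 - p)`, which is at most
-- `-1` exactly when `2 / (1 - p) ≤ C`. A forced stop gives `-(C - 1) ≤ -1` since `2 ≤ C`, and the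
-- descent gives `-1`.
theorem lyapunovFn_drift {C : ℝ} (hC : 2 / (1 - p) ≤ C) {q : Fin (n + 4) → ℕ} (hq : q ≠ 0) :
    p * lyapunovFn C (M.next q true) + (1 - p) * lyapunovFn C (M.next q false) ≤
      lyapunovFn C q - 1 := by
  have hC' : 2 ≤ C * (1 - p) := (div_le_iff₀ (sub_pos.2 h1)).1 hC
  have hC2 : 2 ≤ C := by nlinarith
  by_cases h2 : 0 < q q₂
  · have e : lyapunovFn C (M.mainMove q - Pi.single q₂ 1) = lyapunovFn C q - (C - 1) := by
      rw [lyapunovFn_eq, lyapunovFn_eq, M.sum_mainMove_sub_single hM h2,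
        M.mainMove_sub_single_q₂, Nat.cast_sub (by omega)]
      push_cast
      ring
    rw [M.next_false h2, e]
    by_cases hz : ∀ c, 0 < q c → c = q₁ ∨ c = q₂
    · rw [M.next_of_base_eq_zero h2 hz, e]
      linarith
    · have e' : lyapunovFn C (M.mainMove q) = lyapunovFn C q + 1 := by
        rw [lyapunovFn_eq, lyapunovFn_eq, M.sum_mainMove hM, M.mainMove_q₂]
        push_cast
        ring
      rw [M.next_true h2 hz, e']
      linarith
  · have h2' : q q₂ = 0 := by omega
    have e : lyapunovFn C (downMove q) = lyapunovFn C q - 1 := by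
      rw [lyapunovFn_eq, lyapunovFn_eq, downMove_q₂ h2', h2', ← sum_downMove hq]
      push_cast
      ring
    rw [M.next_of_q₂_eq_zero h2' hq, M.next_of_q₂_eq_zero h2' hq, e]
    linarith

theorem walk_isLinearLyapunov {C : ℝ} (hC : 2 / (1 - p) ≤ C) :
    (M.walk hM p h0 h1).IsLinearLyapunov (lyapunovFn C) 1 {0} := by
  have hC0 : 0 ≤ C := (div_nonneg zero_le_two (sub_pos.2 h1).le).trans hC
  refine ⟨⟨lyapunovFn_nonneg hC0, one_pos, Set.finite_singleton 0, fun q hq => ?_⟩,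
    fun c => if c = q₂ then C else 1, fun c => by positivity, fun q => ?_⟩
  · have hs := M.hasSum_mul_trans hM p h0 h1 q (lyapunovFn C)
    refine ⟨hs.summable, ?_⟩
    rw [hs.tsum_eq]
    have := M.lyapunovFn_drift hM p h0 h1 hC (q := q) (by simpa using hq)
    linarith
  · rw [sum_coord, lyapunovFn]
    have : (q₁ : Fin (n + 4)) ≠ q₂ := by simp [q₁, q₂]
    simp [stateCoord_ne_q₂, counterCoord_ne_q₂, this]

theorem walk_positiveRecurrent : (M.walk hM p h0 h1).PositiveRecurrent := by
  have hC0 : 0 ≤ 2 / (1 - p) := div_nonneg zero_le_two (sub_pos.2 h1).le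
  refine positiveRecurrent_of_drift _
    (fun q => ENNReal.ofReal (lyapunovFn (2 / (1 - p)) q)) (fun q => ENNReal.ofReal_ne_top)
    fun q hq => ?_
  have hd := M.lyapunovFn_drift hM p h0 h1 le_rfl hq
  have hn := fun q : Fin (n + 4) → ℕ => lyapunovFn_nonneg hC0 q
  rw [tsum_trans_mul, ← ENNReal.ofReal_mul h0.le, ← ENNReal.ofReal_mul (sub_pos.2 h1).le,
    ← ENNReal.ofReal_add (mul_nonneg h0.le (hn _)) (mul_nonneg (sub_pos.2 h1).le (hn _)),
    ← ENNReal.ofReal_one, ← ENNReal.ofReal_add zero_le_one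
      (add_nonneg (mul_nonneg h0.le (hn _)) (mul_nonneg (sub_pos.2 h1).le (hn _)))]
  exact ENNReal.ofReal_le_ofReal (by linarith)

theorem walk_communicatesWithZero : (M.walk hM p h0 h1).CommunicatesWithZero := by
  intro q
  -- Outcome `false` has positive probability and always lowers this quantity: with `q₂` positive
  -- the norm is kept and `q₂` drops, otherwise the norm drops.
  induction hN : (∑ c, q c) + q q₂ using Nat.strong_induction_on generalizing q with
  | _ N ih =>
    by_cases hq : q = 0
    · exact ⟨0, by simp [hq, nStep]⟩
    · have hlt : (∑ c, M.next q false c) + M.next q false q₂ < N := by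
        by_cases h2 : 0 < q q₂
        · rw [M.next_false h2, M.sum_mainMove_sub_single hM h2, M.mainMove_sub_single_q₂]
          omega
        · rw [M.next_of_q₂_eq_zero (by omega) hq, downMove_q₂ (by omega), ← hN,
            ← sum_downMove hq]
          omega
      obtain ⟨t, ht⟩ := ih _ hlt _ rfl
      refine ⟨1 + t, nStep_add_pos _ (s := 1) ?_ ht⟩
      have h1' : 0 < ENNReal.ofReal (1 - p) := ENNReal.ofReal_pos.2 (sub_pos.2 h1)
      rw [nStep, nStep, PMF.pure_bind, walk_trans_apply, if_pos rfl]
      exact h1'.trans_le le_add_self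

/-! ### The time to the origin -/

/-- Without the clock both coin outcomes coincide and the descent is deterministic, one unit per
step. -/
theorem pathLaw_hittingTime_of_q₂_eq_zero {q : Fin (n + 4) → ℕ} (h2 : q q₂ = 0) (k : ℕ) :
    (M.walk hM p h0 h1).pathLaw q {ω | hittingTime {0} ω = (k : ℕ∞)} =
      if k = ∑ c, q c then 1 else 0 := by
  induction hN : ∑ c, q c generalizing q k with
  | zero =>
    have hq : q = 0 := funext fun c => Finset.sum_eq_zero_iff.1 hN c (Finset.mem_univ c)
    rw [pathLaw_hittingTime_eq_of_mem _ (by simpa using hq)]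
    simp
  | succ N ih =>
    have hq : q ≠ 0 := by rintro rfl; simp at hN
    have hq' : q ∉ ({0} : Set (Fin (n + 4) → ℕ)) := by simpa using hq
    obtain _ | k := k
    · simpa using pathLaw_hittingTime_eq_zero _ hq'
    · rw [pathLaw_hittingTime_eq_succ _ hq', tsum_trans_mul, M.next_of_q₂_eq_zero h2 hq,
        M.next_of_q₂_eq_zero h2 hq, ofReal_mul_add_ofReal_mul p h0 h1,
        ih (downMove_q₂ h2) k (by have := sum_downMove hq; omega)]
      simp

theorem pathLaw_hittingTime_of_lt_sum {q : Fin (n + 4) → ℕ} {k : ℕ} (hk : k < ∑ c, q c) :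
    (M.walk hM p h0 h1).pathLaw q {ω | hittingTime {0} ω = (k : ℕ∞)} = 0 := by
  induction k generalizing q with
  | zero =>
    have hq : q ∉ ({0} : Set (Fin (n + 4) → ℕ)) := by rintro rfl; simp at hk
    simpa using pathLaw_hittingTime_eq_zero _ hq
  | succ k ih =>
    have hq : q ∉ ({0} : Set (Fin (n + 4) → ℕ)) := by rintro rfl; simp at hk
    have hn := M.le_sum_next hM q
    rw [pathLaw_hittingTime_eq_succ _ hq, tsum_trans_mul, ih (by have := hn true; omega),
      ih (by have := hn false; omega)]
    simp

/-! ### The simulation of the machine -/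

/-- The states and counters of `q` encode the configuration `c`. -/
def Represents (q : Fin (n + 4) → ℕ) (c : Fin (n + 1) × (Fin 2 → ℕ)) : Prop :=
  (∀ k : Fin n, q (stateCoord k) = if (k : ℕ) + 1 = c.1 then 1 else 0) ∧
    ∀ i, q (counterCoord i) = c.2 i

theorem stateVec_stateCoord (s : Fin (n + 1)) (k : Fin n) :
    stateVec s (stateCoord k) = if (k : ℕ) + 1 = s then 1 else 0 := rfl

theorem stateVec_counterCoord (s : Fin (n + 1)) (i : Fin 2) : stateVec s (counterCoord i) = 0 := by
  unfold stateVec counterCoord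
  rw [if_neg]
  simp only
  omega

theorem opVec_stateCoord (o : CounterOp) (k : Fin n) : opVec o (stateCoord k) = 0 := by
  unfold opVec
  refine Finset.sum_eq_zero fun i _ => if_neg ?_
  simp only [stateCoord, counterCoord, Fin.mk.injEq]
  omega

theorem opVec_counterCoord (o : CounterOp) (i : Fin 2) :
    opVec o (counterCoord i : Fin (n + 4)) = o.delta i := by
  unfold opVec
  rw [Finset.sum_eq_single i]
  · simp
  · intro j _ hj
    refine if_neg fun h => hj ?_
    simp only [counterCoord, Fin.mk.injEq] at h
    omega
  · simp

/-- The simulation step: the face of `q` shows the machine state and the signs of the counters,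
which is all that `Γ` reads. -/
theorem Represents.mainMove {q : Fin (n + 4) → ℕ} {c : Fin (n + 1) × (Fin 2 → ℕ)}
    (h : Represents q c) : Represents (M.mainMove q) (M.step c) := by
  have he : Encodes (face q) c.1 := by
    intro k
    rw [mem_face, h.1]
    split_ifs with hk <;> simp [hk]
  have hb : M.baseJump (face q) = stateVec (M.Γ c.1 fun i => decide (0 < c.2 i)).1 - stateVec c.1
      + opVec (M.Γ c.1 fun i => decide (0 < c.2 i)).2 := by
    have hd : (fun i => decide (counterCoord i ∈ face q)) = fun i => decide (0 < c.2 i) := by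
      funext i
      simp [mem_face, h.2]
    rw [M.baseJump_of_encodes he, hd]
  have hstep : M.step c = ((M.Γ c.1 fun i => decide (0 < c.2 i)).1, fun i =>
      ((c.2 i : ℤ) + (M.Γ c.1 fun i => decide (0 < c.2 i)).2.delta i).toNat) := rfl
  generalize (M.Γ c.1 fun i => decide (0 < c.2 i)) = r at hb hstep
  rw [hstep]
  refine ⟨fun k => ?_, fun i => ?_⟩
  · simp only [CounterMachine.mainMove, mainJump, hb, Pi.add_apply, Pi.sub_apply, opVec_stateCoord,
      stateVec_stateCoord, h.1, Pi.single_eq_of_ne (stateCoord_ne_q₁ k)]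
    split_ifs <;> simp
  · simp only [CounterMachine.mainMove, mainJump, hb, Pi.add_apply, Pi.sub_apply,
      opVec_counterCoord, stateVec_counterCoord, h.2,
      Pi.single_eq_of_ne (counterCoord_ne_q₁ i)]
    simp

theorem Represents.add_single {q : Fin (n + 4) → ℕ} {c : Fin (n + 1) × (Fin 2 → ℕ)}
    (h : Represents q c) : Represents (q + Pi.single q₂ 1) c :=
  ⟨fun k => by simpa [stateCoord_ne_q₂] using h.1 k,
    fun i => by simpa [counterCoord_ne_q₂] using h.2 i⟩

theorem represents_zero : Represents (0 : Fin (n + 4) → ℕ) (0, 0) :=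
  ⟨fun k => by simp, fun i => rfl⟩

theorem Represents.base_eq_zero_iff {q : Fin (n + 4) → ℕ} {c : Fin (n + 1) × (Fin 2 → ℕ)}
    (h : Represents q c) : (∀ a, 0 < q a → a = q₁ ∨ a = q₂) ↔ c = (0, 0) := by
  constructor
  · intro hz
    refine Prod.ext (Fin.ext ?_) (funext fun i => ?_)
    · by_contra hne
      have hne' : (c.1 : ℕ) ≠ 0 := hne
      have hlt := c.1.2
      have h1 := h.1 ⟨(c.1 : ℕ) - 1, by omega⟩
      rw [if_pos (Nat.sub_add_cancel (Nat.pos_of_ne_zero hne'))] at h1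
      exact (hz _ (Nat.lt_of_lt_of_eq Nat.zero_lt_one h1.symm)).elim
        (stateCoord_ne_q₁ _) (stateCoord_ne_q₂ _)
    · by_contra hne
      have h1 := h.2 i
      exact (hz (counterCoord i) (by simp at hne; omega)).elim
        (counterCoord_ne_q₁ _) (counterCoord_ne_q₂ _)
  · rintro rfl a ha
    obtain ⟨k, rfl⟩ | ⟨i, rfl⟩ | ha' := coord_cases a
    · simp [h.1] at ha
    · simp [h.2] at ha
    · exact ha'

open Classical in
-- Continuing for `m` steps costs time `m` and adds `m` to the norm; the stopping step costs one and
-- keeps the norm, which the descent then consumes. This gives `∑ c, q c + 2 * m + 1`. The last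
-- factor is `1` when the stop is forced.
theorem pathLaw_hittingTime_of_represents {q : Fin (n + 4) → ℕ}
    {c : Fin (n + 1) × (Fin 2 → ℕ)} (h : Represents q c) (h2 : q q₂ = 1) (m : ℕ)
    (hne : ∀ i < m, M.step^[i] c ≠ (0, 0)) :
    (M.walk hM p h0 h1).pathLaw q
        {ω | hittingTime {0} ω = ((∑ c, q c + 2 * m + 1 : ℕ) : ℕ∞)} =
      ENNReal.ofReal p ^ m * if M.step^[m] c = (0, 0) then 1 else ENNReal.ofReal (1 - p) := by
  induction m generalizing q c with
  | zero =>
    have hpos : 0 < q q₂ := by omega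
    have hq : q ∉ ({0} : Set (Fin (n + 4) → ℕ)) := by rintro rfl; simp at h2
    have hs := M.sum_mainMove_sub_single hM hpos
    have hz : (M.mainMove q - Pi.single q₂ 1 : Fin (n + 4) → ℕ) q₂ = 0 := by
      rw [mainMove_sub_single_q₂, h2]
    rw [pathLaw_hittingTime_eq_succ _ hq, tsum_trans_mul, M.next_false hpos,
      M.pathLaw_hittingTime_of_q₂_eq_zero hM p h0 h1 hz, hs]
    by_cases hc : c = (0, 0)
    · rw [M.next_of_base_eq_zero hpos (h.base_eq_zero_iff.2 hc),
        M.pathLaw_hittingTime_of_q₂_eq_zero hM p h0 h1 hz, hs, ofReal_mul_add_ofReal_mul p h0 h1]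
      simp [hc]
    -- If the clock goes on, the norm exceeds the remaining time, so this branch contributes
    -- nothing.
    · rw [M.next_true hpos (mt h.base_eq_zero_iff.1 hc),
        M.pathLaw_hittingTime_of_lt_sum hM p h0 h1 (by rw [M.sum_mainMove hM]; omega)]
      simp [hc]
  | succ m ih =>
    have hpos : 0 < q q₂ := by omega
    have hq : q ∉ ({0} : Set (Fin (n + 4) → ℕ)) := by rintro rfl; simp at h2
    have hz : (M.mainMove q - Pi.single q₂ 1 : Fin (n + 4) → ℕ) q₂ = 0 := by
      rw [mainMove_sub_single_q₂, h2]
    have hc : c ≠ (0, 0) := hne 0 (by omega)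
    have ih' := ih (h.mainMove M) (by rw [mainMove_q₂, h2]) fun i hi => by
      rw [← Function.iterate_succ_apply]
      exact hne (i + 1) (by omega)
    -- The extra unit of norm and the step just taken account for the two additional time units.
    rw [M.sum_mainMove hM, show ∑ c, q c + 1 + 2 * m + 1 = ∑ c, q c + 2 * (m + 1) by ring] at ih'
    rw [pathLaw_hittingTime_eq_succ _ hq, tsum_trans_mul, M.next_false hpos,
      M.next_true hpos (mt h.base_eq_zero_iff.1 hc), ih',
      M.pathLaw_hittingTime_of_q₂_eq_zero hM p h0 h1 hz, M.sum_mainMove_sub_single hM hpos,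
      if_neg (show ¬ ∑ c, q c + 2 * (m + 1) = ∑ c, q c by omega), mul_zero, add_zero,
      Function.iterate_succ_apply, pow_succ', mul_assoc]

open Classical in
-- The first step is separate: at the origin the coin starts the clock instead of stopping it. The
-- condition `1 ≤ t` is needed because `config 0` is already the halting configuration.
theorem pathLaw_returnTime (t : ℕ) (hne : ∀ i, 1 ≤ i → i < t → M.config i ≠ (0, 0)) :
    (M.walk hM p h0 h1).pathLaw 0 {ω | returnTime ω = ((2 * t + 2 : ℕ) : ℕ∞)} =
      ENNReal.ofReal p ^ t *
        if 1 ≤ t ∧ M.config t = (0, 0) then 1 else ENNReal.ofReal (1 - p) := by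
  have hs0 : ∑ c, M.mainMove 0 c = 1 := by simp [M.sum_mainMove hM]
  have hs1 : ∑ c, (M.mainMove 0 + Pi.single q₂ 1 : Fin (n + 4) → ℕ) c = 2 := by
    simp [Finset.sum_add_distrib, hs0]
  have hz : M.mainMove 0 q₂ = 0 := M.mainMove_q₂ 0
  rw [pathLaw_returnTime_eq_succ, tsum_trans_mul, next_zero, next_zero, if_pos rfl,
    if_neg Bool.false_ne_true, M.pathLaw_hittingTime_of_q₂_eq_zero hM p h0 h1 hz, hs0]
  obtain _ | m := t
  -- Once the clock starts, the norm is two and a single remaining step is too short.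
  · rw [M.pathLaw_hittingTime_of_lt_sum hM p h0 h1 (by rw [hs1]; omega)]
    simp
  · have hr : Represents (M.mainMove 0 + Pi.single q₂ 1) (M.step (0, 0)) :=
      (represents_zero.mainMove M).add_single
    have key := M.pathLaw_hittingTime_of_represents hM p h0 h1 hr (by simp [hz]) m fun i hi => by
      rw [← Function.iterate_succ_apply]
      exact hne (i + 1) (by omega) (by omega)
    rw [hs1, ← Function.iterate_succ_apply,
      show 2 + 2 * m + 1 = 2 * (m + 1) + 1 by ring] at key
    rw [key, if_neg (show ¬ 2 * (m + 1) + 1 = 1 by omega), mul_zero, add_zero, pow_succ', mul_assoc]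
    simp only [config, Nat.le_add_left, true_and, Nat.succ_eq_add_one]

end

end CounterMachine

/-! ### The law of the return time -/

theorem MeasureTheory.lintegral_enat_of_tsum_eq_one {Ω ι : Type*} [MeasurableSpace Ω]
    [Countable ι] (μ : Measure Ω) [IsProbabilityMeasure μ] {τ : Ω → ℕ∞} (hτ : Measurable τ)
    {v : ι → ℕ} (hv : Function.Injective v) (h : ∑' i, μ {ω | τ ω = v i} = 1) :
    ∫⁻ ω, (τ ω : ℝ≥0∞) ∂μ = ∑' i, (v i : ℝ≥0∞) * μ {ω | τ ω = v i} := by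
  have hm : ∀ i, MeasurableSet {ω | τ ω = v i} := fun i => hτ (measurableSet_singleton _)
  have hd : Pairwise (Function.onFun Disjoint fun i => {ω | τ ω = v i}) := by
    intro i j hij
    refine Set.disjoint_left.2 fun ω hi hj => hij (hv ?_)
    have : ((v i : ℕ) : ℕ∞) = v j := hi.symm.trans hj
    exact_mod_cast this
  have hae : ∀ᵐ ω ∂μ, ω ∈ ⋃ i, {ω | τ ω = v i} := by
    rw [← measure_iUnion hd hm] at h
    exact (prob_compl_eq_zero_iff (MeasurableSet.iUnion hm)).2 h
  have hsum : ∀ᵐ ω ∂μ, (τ ω : ℝ≥0∞) =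
      ∑' i, ({ω | τ ω = v i}).indicator (fun _ => (v i : ℝ≥0∞)) ω := by
    filter_upwards [hae] with ω hω
    obtain ⟨i, hi⟩ := Set.mem_iUnion.1 hω
    have hi' : τ ω = v i := hi
    rw [tsum_eq_single i, Set.indicator_of_mem hi, hi', ENat.toENNReal_coe]
    intro j hj
    exact Set.indicator_of_notMem (fun h => Set.disjoint_left.1 (hd hj) h hi) _
  rw [lintegral_congr_ae hsum, lintegral_tsum fun i =>
    (measurable_const.indicator (hm i)).aemeasurable]
  exact tsum_congr fun i => lintegral_indicator_const (hm i) _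

theorem hasSum_geometric_weights {p : ℝ} (h0 : 0 < p) (h1 : p < 1) :
    HasSum (fun t : ℕ => (1 - p) * p ^ t) 1 := by
  have := (hasSum_geometric_of_lt_one h0.le h1).mul_left (1 - p)
  rwa [mul_inv_cancel₀ (sub_pos.2 h1).ne'] at this

theorem hasSum_geometric_mean {p : ℝ} (h0 : 0 < p) (h1 : p < 1) :
    HasSum (fun t : ℕ => ((2 * t + 2 : ℕ) : ℝ) * ((1 - p) * p ^ t)) (2 / (1 - p)) := by
  have hp : 1 - p ≠ 0 := (sub_pos.2 h1).ne'
  have h := hasSum_coe_mul_geometric_of_norm_lt_one (𝕜 := ℝ) (r := p)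
    (by rwa [Real.norm_of_nonneg h0.le])
  have h' := (h.mul_left (2 * (1 - p))).add ((hasSum_geometric_weights h0 h1).mul_left 2)
  have e : 2 * (1 - p) * (p / (1 - p) ^ 2) + 2 * 1 = 2 / (1 - p) := by
    field_simp
    ring
  rw [e] at h'
  have e' : (fun t : ℕ => ((2 * t + 2 : ℕ) : ℝ) * ((1 - p) * p ^ t)) =
      fun t : ℕ => 2 * (1 - p) * (t * p ^ t) + 2 * ((1 - p) * p ^ t) := by
    funext t
    push_cast
    ring
  rw [e']
  exact h'

theorem sum_truncated_geometric_weights (p : ℝ) (T : ℕ) :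
    ∑ t ∈ Finset.range T, (1 - p) * p ^ t + p ^ T = 1 := by
  induction T with
  | zero => simp
  | succ T ih => rw [Finset.sum_range_succ]; linear_combination ih

theorem sum_truncated_geometric_mean {p : ℝ} (h1 : p < 1) (T : ℕ) :
    ∑ t ∈ Finset.range T, ((2 * t + 2 : ℕ) : ℝ) * ((1 - p) * p ^ t) + (2 * T + 2 : ℕ) * p ^ T =
      (2 - 2 * p ^ (T + 1)) / (1 - p) := by
  have hp : 1 - p ≠ 0 := (sub_pos.2 h1).ne'
  rw [eq_div_iff hp]
  induction T with
  | zero => simp; ring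
  | succ T ih =>
    rw [Finset.sum_range_succ]
    push_cast at ih ⊢
    linear_combination ih

/-! ### Return times of halting and non-halting machines -/

namespace CounterMachine

open ConstrainedWalk

variable {n : ℕ} (M : CounterMachine n) (hM : M.NoIncrementOnLeaving) (p : ℝ) (h0 : 0 < p)
  (h1 : p < 1)

theorem exists_haltsIn {t : ℕ} (ht : 1 ≤ t) (h : M.config t = (0, 0)) :
    ∃ T, T ≤ t ∧ M.HaltsIn T := by
  classical
  have hex : ∃ t, 1 ≤ t ∧ M.config t = (0, 0) := ⟨t, ht, h⟩
  exact ⟨Nat.find hex, Nat.find_min' hex ⟨ht, h⟩, (Nat.find_spec hex).1, (Nat.find_spec hex).2,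
    fun s hs hlt hz => Nat.find_min hex hlt ⟨hs, hz⟩⟩

theorem pathLaw_returnTime_of_forall_ne (t : ℕ)
    (hne : ∀ i, 1 ≤ i → i ≤ t → M.config i ≠ (0, 0)) :
    (M.walk hM p h0 h1).pathLaw 0 {ω | returnTime ω = ((2 * t + 2 : ℕ) : ℕ∞)} =
      ENNReal.ofReal ((1 - p) * p ^ t) := by
  rw [M.pathLaw_returnTime hM p h0 h1 t fun i h1 h2 => hne i h1 h2.le,
    if_neg fun h => hne t h.1 le_rfl h.2, mul_comm, ← ENNReal.ofReal_pow h0.le,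
    ENNReal.ofReal_mul (sub_pos.2 h1).le]

theorem pathLaw_returnTime_of_haltsIn {T : ℕ} (hT : M.HaltsIn T) :
    (M.walk hM p h0 h1).pathLaw 0 {ω | returnTime ω = ((2 * T + 2 : ℕ) : ℕ∞)} =
      ENNReal.ofReal (p ^ T) := by
  rw [M.pathLaw_returnTime hM p h0 h1 T hT.2.2, if_pos ⟨hT.1, hT.2.1⟩, mul_one,
    ENNReal.ofReal_pow h0.le]

theorem lintegral_returnTime_of_not_haltsIn (hne : ∀ T, ¬ M.HaltsIn T) :
    ∫⁻ ω, (returnTime ω : ℝ≥0∞) ∂(M.walk hM p h0 h1).pathLaw 0 =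
      ENNReal.ofReal (2 / (1 - p)) := by
  have hlaw : ∀ t : ℕ, (M.walk hM p h0 h1).pathLaw 0
      {ω | returnTime ω = ((2 * t + 2 : ℕ) : ℕ∞)} = ENNReal.ofReal ((1 - p) * p ^ t) := fun t =>
    M.pathLaw_returnTime_of_forall_ne hM p h0 h1 t fun i hi _ h =>
      let ⟨T, _, hT⟩ := M.exists_haltsIn hi h
      hne T hT
  have hnn : ∀ t : ℕ, 0 ≤ (1 - p) * p ^ t := fun t =>
    mul_nonneg (sub_pos.2 h1).le (pow_nonneg h0.le t)
  have hw := hasSum_geometric_weights h0 h1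
  have hmean := hasSum_geometric_mean h0 h1
  rw [lintegral_enat_of_tsum_eq_one _ measurable_returnTime (v := fun t : ℕ => 2 * t + 2)
    (fun a b h => by simpa using h)]
  · simp_rw [hlaw]
    rw [← hmean.tsum_eq, ENNReal.ofReal_tsum_of_nonneg
      (fun t => mul_nonneg (Nat.cast_nonneg _) (hnn t)) hmean.summable]
    refine tsum_congr fun t => ?_
    rw [ENNReal.ofReal_mul (Nat.cast_nonneg _), ENNReal.ofReal_natCast]
  · simp_rw [hlaw]
    rw [← ENNReal.ofReal_tsum_of_nonneg hnn hw.summable, hw.tsum_eq, ENNReal.ofReal_one]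

theorem lintegral_returnTime_of_haltsIn {T : ℕ} (hT : M.HaltsIn T) :
    ∫⁻ ω, (returnTime ω : ℝ≥0∞) ∂(M.walk hM p h0 h1).pathLaw 0 =
      ENNReal.ofReal ((2 - 2 * p ^ (T + 1)) / (1 - p)) := by
  have hlaw : ∀ t < T, (M.walk hM p h0 h1).pathLaw 0
      {ω | returnTime ω = ((2 * t + 2 : ℕ) : ℕ∞)} = ENNReal.ofReal ((1 - p) * p ^ t) :=
    fun t ht => M.pathLaw_returnTime_of_forall_ne hM p h0 h1 t fun i hi hit =>
      hT.2.2 i hi (by omega)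
  have hlast := M.pathLaw_returnTime_of_haltsIn hM p h0 h1 hT
  have hnn : ∀ t : ℕ, 0 ≤ (1 - p) * p ^ t := fun t =>
    mul_nonneg (sub_pos.2 h1).le (pow_nonneg h0.le t)
  have hpT : 0 ≤ p ^ T := pow_nonneg h0.le T
  rw [lintegral_enat_of_tsum_eq_one _ measurable_returnTime
    -- A finite index type that includes `T`, whose atom carries the whole truncated tail `p ^ T`.
    (v := fun t : Finset.range (T + 1) => 2 * (t : ℕ) + 2)
    (fun a b h => Subtype.ext (by simpa using h)),
    Finset.tsum_subtype (Finset.range (T + 1)) fun t => ((2 * t + 2 : ℕ) : ℝ≥0∞) *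
      (M.walk hM p h0 h1).pathLaw 0 {ω | returnTime ω = ((2 * t + 2 : ℕ) : ℕ∞)}]
  · rw [← sum_truncated_geometric_mean h1, Finset.sum_range_succ, hlast,
      ENNReal.ofReal_add (Finset.sum_nonneg fun t _ => mul_nonneg (Nat.cast_nonneg _) (hnn t))
        (mul_nonneg (Nat.cast_nonneg _) hpT),
      ENNReal.ofReal_sum_of_nonneg fun t _ => mul_nonneg (Nat.cast_nonneg _) (hnn t),
      ENNReal.ofReal_mul (Nat.cast_nonneg _), ENNReal.ofReal_natCast]
    congr 1
    refine Finset.sum_congr rfl fun t ht => ?_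
    rw [hlaw t (Finset.mem_range.1 ht), ENNReal.ofReal_mul (Nat.cast_nonneg _),
      ENNReal.ofReal_natCast]
  · rw [Finset.tsum_subtype (Finset.range (T + 1)) fun t =>
      (M.walk hM p h0 h1).pathLaw 0 {ω | returnTime ω = ((2 * t + 2 : ℕ) : ℕ∞)},
      Finset.sum_range_succ, hlast, Finset.sum_congr rfl fun t ht =>
        hlaw t (Finset.mem_range.1 ht), ← ENNReal.ofReal_sum_of_nonneg fun t _ => hnn t,
      ← ENNReal.ofReal_add (Finset.sum_nonneg fun t _ => hnn t) hpT,
      sum_truncated_geometric_weights, ENNReal.ofReal_one]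

/-- Finiteness holds in either case, so the stationary law can be constructed before it is known
whether the machine halts. -/
theorem lintegral_returnTime_ne_top :
    ∫⁻ ω, (returnTime ω : ℝ≥0∞) ∂(M.walk hM p h0 h1).pathLaw 0 ≠ ∞ := by
  by_cases h : ∃ T, M.HaltsIn T
  · obtain ⟨T, hT⟩ := h
    rw [M.lintegral_returnTime_of_haltsIn hM p h0 h1 hT]
    exact ENNReal.ofReal_ne_top
  · rw [M.lintegral_returnTime_of_not_haltsIn hM p h0 h1 (not_exists.1 h)]
    exact ENNReal.ofReal_ne_top

end CounterMachine

theorem proposition1 {n : ℕ} (M : CounterMachine n) (hM : M.NoIncrementOnLeaving)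
    (p : ℝ) (h0 : 0 < p) (h1 : p < 1) :
    (M.walk hM p h0 h1).CommunicatesWithZero ∧
    (M.walk hM p h0 h1).Irreducible ∧
    (M.walk hM p h0 h1).PositiveRecurrent ∧
    (∃ π : PMF (Fin (n + 4) → ℕ),
      (M.walk hM p h0 h1).IsStationary π ∧
      (∀ π' : PMF (Fin (n + 4) → ℕ), (M.walk hM p h0 h1).IsStationary π' → π' = π) ∧
      ((∀ T : ℕ, ¬ M.HaltsIn T) →
        (∀ t : ℕ, (M.walk hM p h0 h1).pathLaw 0
            {ω | ConstrainedWalk.returnTime ω = ((2 * t + 2 : ℕ) : ℕ∞)}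
              = ENNReal.ofReal ((1 - p) * p ^ t)) ∧
        ∫⁻ ω, (ConstrainedWalk.returnTime ω : ℝ≥0∞) ∂(M.walk hM p h0 h1).pathLaw 0
          = ENNReal.ofReal (2 / (1 - p)) ∧
        1 / (π 0).toReal = 2 / (1 - p)) ∧
      (∀ T : ℕ, M.HaltsIn T →
        (∀ t : ℕ, t < T → (M.walk hM p h0 h1).pathLaw 0
            {ω | ConstrainedWalk.returnTime ω = ((2 * t + 2 : ℕ) : ℕ∞)}
              = ENNReal.ofReal ((1 - p) * p ^ t)) ∧
        (M.walk hM p h0 h1).pathLaw 0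
            {ω | ConstrainedWalk.returnTime ω = ((2 * T + 2 : ℕ) : ℕ∞)}
              = ENNReal.ofReal (p ^ T) ∧
        ∫⁻ ω, (ConstrainedWalk.returnTime ω : ℝ≥0∞) ∂(M.walk hM p h0 h1).pathLaw 0
          = ENNReal.ofReal ((2 - 2 * p ^ (T + 1)) / (1 - p)) ∧
        1 / (π 0).toReal = (2 - 2 * p ^ (T + 1)) / (1 - p))) ∧
    (∀ C : ℝ, 2 / (1 - p) ≤ C →
      (M.walk hM p h0 h1).IsLinearLyapunov (CounterMachine.lyapunovFn C) 1 {0}) := by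
  have hfin := M.lintegral_returnTime_ne_top hM p h0 h1
  have hc := M.walk_communicatesWithZero hM p h0 h1
  have hp : 0 < 1 - p := sub_pos.2 h1
  obtain ⟨π, hπ, huniq, hπ0⟩ := ConstrainedWalk.exists_unique_stationary _ hc hfin
  refine ⟨hc, hc.irreducible, M.walk_positiveRecurrent hM p h0 h1, ⟨π, hπ, huniq,
    fun hne => ⟨fun t => ?_, ?_, ?_⟩, fun T hT => ⟨fun t ht => ?_, ?_, ?_, ?_⟩⟩,
    fun C hC => M.walk_isLinearLyapunov hM p h0 h1 hC⟩
  · exact M.pathLaw_returnTime_of_forall_ne hM p h0 h1 t fun i hi _ h =>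
      let ⟨T, _, hT⟩ := M.exists_haltsIn hi h
      hne T hT
  · exact M.lintegral_returnTime_of_not_haltsIn hM p h0 h1 hne
  · rw [hπ0, M.lintegral_returnTime_of_not_haltsIn hM p h0 h1 hne, ENNReal.toReal_inv,
      ENNReal.toReal_ofReal (div_nonneg zero_le_two hp.le), one_div, inv_inv]
  · exact M.pathLaw_returnTime_of_forall_ne hM p h0 h1 t fun i hi hit =>
      hT.2.2 i hi (by omega)
  · exact M.pathLaw_returnTime_of_haltsIn hM p h0 h1 hT
  · exact M.lintegral_returnTime_of_haltsIn hM p h0 h1 hT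
  · have hpow : p ^ (T + 1) ≤ 1 := pow_le_one₀ h0.le h1.le
    rw [hπ0, M.lintegral_returnTime_of_haltsIn hM p h0 h1 hT, ENNReal.toReal_inv,
      ENNReal.toReal_ofReal (div_nonneg (by linarith) hp.le), one_div, inv_inv]
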